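/- Let $\Omega\subset\mathbb R^2$ be a bounded polygonal domain (connected, with boundary a finite disjoint union of simple closed polygonal curves), $\partial\Omega=\Gamma_D\cup\Gamma_N$ with $\Gamma_D\cap\Gamma_N=\emptyset$ and $\Gamma_D\neq\emptyset$. Let $f\in L^2(\Omega)$, and let $\kappa$ satisfy $0<k_*\le\kappa\le k^*<\infty$ a.e. in $\Omega$. **Continuous problems.** Let $\widetilde u\in H^1(\Omega)$, $\widetilde u=g_D$ on $\Gamma_D$, solve $(\kappa\nabla\widetilde u,\nabla v)_{0,\Omega}=(f,v)_{0,\Omega}+(g_N,v)_{0,\Gamma_N}$ for all $v\in H^1(\Omega)$ with $v=0$ on $\Gamma_D$. Let $(\boldsymbol\sigma,u)\in H(\mathrm{div},\Omega)\times L^2(\Omega)$, $\mathbf n\cdot\boldsymbol\sigma=-g_N$ on $\Gamma_N$, solve the mixed formulation $$\int_\Omega\kappa^{-1}\boldsymbol\sigma\cdot\boldsymbol\tau-\int_\Omega \mathrm{div}(\boldsymbol\tau)\,u=-(g_D,\mathbf n\cdot\boldsymbol\tau)_{0,\Gamma_D},\qquad -\int_\Omega\mathrm{div}(\boldsymbol\sigma)\,v=(-f,v)_{0,\Omega}$$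 for all $\boldsymbol\tau\in H(\mathrm{div},\Omega)$ with $\mathbf n\cdot\boldsymbol\tau=0$ on $\Gamma_N$ and all $v\in L^2(\Omega)$; boundary terms are duality pairings. **Mesh.** Let $\mathcal T_n$ be a conforming decomposition of $\Omega$ into finitely many polygons (hanging nodes count as vertices), conforming also with respect to $\Gamma_D$ and $\Gamma_N$. Let $p\ge1$ and $\gamma,\widetilde\gamma>0$, and assume: (G1) every $K\in\mathcal T_n$ is star-shaped with respect to a ball of radius $\ge\gamma h_K$, where $h_K$ is the diameter of $K$; (G2) $h_K\le\widetilde\gamma\,h_e$ for each edge $e$ of $K$ of length $h_e$; (K) $\kappa$ is constant on each $K$; (D) $g_D$ and $g_N$ are polynomials of degree $\le p$ on each mesh edge in $\Gamma_D$ and $\Gamma_N$, respectively. Write $\mathbb P_\ell$ for the polynomials of total degree at most $\ell$ ($\mathbb P_{-1}=\{0\}$), and $\widetilde a^K(v,w)=\int_K\kappa\nabla v\cdot\nabla w$, $a^K(\boldsymbol\sigma,\boldsymbol\tau)=\int_K\kappa^{-1}\boldsymbol\sigma\cdot\boldsymbol\tau$. **Primal virtual element method.** Let $\widetilde V_n(K)$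 be the space of the $v\in C^0(\overline K)\cap H^1(K)$ with $v|_e\in\mathbb P_p(e)$ for each edge $e$ of $K$ and $\Delta v\in\mathbb P_{p-2}(K)$. The projector $\widetilde\Pi^\nabla_p:\widetilde V_n(K)\to\mathbb P_p(K)$ is given by $\widetilde a^K(v-\widetilde\Pi^\nabla_pv,q)=0$ for all $q\in\mathbb P_p(K)$ and $\int_{\partial K}(v-\widetilde\Pi^\nabla_pv)=0$. Let $\widetilde S^K$ be a bilinear form on $\ker\widetilde\Pi^\nabla_p$ with $\widetilde\alpha_*\widetilde a^K(v,v)\le\widetilde S^K(v,v)\le\widetilde\alpha^*\widetilde a^K(v,v)$, where $0<\widetilde\alpha_*\le\widetilde\alpha^*<\infty$ may depend on $K$. Let $\widetilde u_n\in C^0(\overline\Omega)$, with $\widetilde u_n|_K\in\widetilde V_n(K)$ for all $K$ and $\widetilde u_n=g_D$ on $\Gamma_D$, solve $$\sum_K\big[\widetilde a^K(\widetilde\Pi^\nabla_p\widetilde u_n,\widetilde\Pi^\nabla_pv)+\widetilde S^K((I-\widetilde\Pi^\nabla_p)\widetilde u_n,(I-\widetilde\Pi^\nabla_p)v)\big]=\langle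 f,v\rangle_n+(g_N,v)_{0,\Gamma_N}$$ for all $v$ in the same space with zero values on $\Gamma_D$. Here $\langle f,v\rangle_n=\sum_K(f,\widetilde\Pi^0_{p-2}v)_{0,K}$ if $p\ge2$, with $\widetilde\Pi^0_{p-2}$ the $L^2(K)$ projector onto $\mathbb P_{p-2}(K)$, and for $p=1$ it is the sum over $K$ of $\int_Kf$ times the mean of $v$ over the vertices of $K$. **Mixed virtual element method.** Let $\boldsymbol\Sigma_n(K)$ be the space of the $\boldsymbol\tau\in H(\mathrm{div},K)\cap H(\mathrm{rot},K)$ with $\mathbf n\cdot\boldsymbol\tau|_e\in\mathbb P_p(e)$ for each edge $e$ of $K$ and $\mathrm{div}\,\boldsymbol\tau,\ \mathrm{rot}\,\boldsymbol\tau\in\mathbb P_{p-1}(K)$. The projector $\boldsymbol\Pi^0_p:\boldsymbol\Sigma_n(K)\to\nabla\mathbb P_{p+1}(K)$ is orthogonal with respect to $a^K$. Let $S^K$ be a bilinear form on $\ker\boldsymbol\Pi^0_p$ with $\alpha_*a^K(\boldsymbol\tau,\boldsymbol\tau)\le S^K(\boldsymbol\tau,\boldsymbol\tau)\le\alpha^*a^K(\boldsymbol\tau,\boldsymbol\tau)$,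 where $0<\alpha_*\le\alpha^*<\infty$ may depend on $K$. Let $\boldsymbol\sigma_n\in H(\mathrm{div},\Omega)$, with $\boldsymbol\sigma_n|_K\in\boldsymbol\Sigma_n(K)$ for all $K$ and $\mathbf n\cdot\boldsymbol\sigma_n=-g_N$ on $\Gamma_N$, and $u_n$, piecewise in $\mathbb P_{p-1}$, solve $$\sum_K\big[a^K(\boldsymbol\Pi^0_p\boldsymbol\sigma_n,\boldsymbol\Pi^0_p\boldsymbol\tau)+S^K((\mathbf I-\boldsymbol\Pi^0_p)\boldsymbol\sigma_n,(\mathbf I-\boldsymbol\Pi^0_p)\boldsymbol\tau)\big]-\int_\Omega\mathrm{div}(\boldsymbol\tau)u_n=-(g_D,\mathbf n\cdot\boldsymbol\tau)_{0,\Gamma_D},\quad -\int_\Omega\mathrm{div}(\boldsymbol\sigma_n)v=(-f,v)_{0,\Omega}$$ for all $\boldsymbol\tau$ in the same space with $\mathbf n\cdot\boldsymbol\tau=0$ on $\Gamma_N$ and all $v$ piecewise in $\mathbb P_{p-1}$. **Estimator.** For $K\in\mathcal T_n$ put $$\eta_{\mathrm{eq},K}^2=\|\kappa^{1/2}\nabla\widetilde\Pi^\nabla_p\widetilde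 u_n+\kappa^{-1/2}\boldsymbol\Pi^0_p\boldsymbol\sigma_n\|_{0,K}^2+\widetilde S^K((I-\widetilde\Pi^\nabla_p)\widetilde u_n,(I-\widetilde\Pi^\nabla_p)\widetilde u_n)+S^K((\mathbf I-\boldsymbol\Pi^0_p)\boldsymbol\sigma_n,(\mathbf I-\boldsymbol\Pi^0_p)\boldsymbol\sigma_n).$$ **Theorem (efficiency).** For every $K\in\mathcal T_n$, $$\begin{aligned}\eta_{\mathrm{eq},K}^2\le{}&4(1+\widetilde\alpha^*)\|\kappa^{1/2}\nabla(\widetilde u-\widetilde u_n)\|_{0,K}^2+2(2+\widetilde\alpha^*)\|\kappa^{1/2}\nabla(\widetilde u-\widetilde\Pi^\nabla_p\widetilde u_n)\|_{0,K}^2\\&+4(1+\alpha^*)\|\kappa^{-1/2}(\boldsymbol\sigma-\boldsymbol\sigma_n)\|_{0,K}^2+2(2+\alpha^*)\|\kappa^{-1/2}(\boldsymbol\sigma-\boldsymbol\Pi^0_p\boldsymbol\sigma_n)\|_{0,K}^2.\end{aligned}$$ The same bound holds with $\widetilde\Pi^\nabla_p\widetilde u_n$ and $\boldsymbol\Pi^0_p\boldsymbol\sigma_n$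 on the right-hand side replaced by an arbitrary $q\in\mathbb P_p(K)$ and by $\nabla r$ with an arbitrary $r\in\mathbb P_{p+1}(K)$, so in particular by the best local approximations of $\widetilde u$ and $\boldsymbol\sigma$. -/

import Mathlib

open MeasureTheory Filter Topology
open scoped ContDiff

namespace HypercircleVEM

noncomputable section

/-- The Euclidean plane. -/
abbrev Plane := EuclideanSpace ℝ (Fin 2)

/-! ### Polygons -/

/-- Unit normal of the oriented segment `e` that points to the right of `e`
(the tangent vector rotated clockwise by a right angle). -/
def outNormal (e : Plane × Plane) : Plane :=
  ‖e.2 - e.1‖⁻¹ • !₂[(e.2 - e.1) 1, -((e.2 - e.1) 0)]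

/-- A bounded (Lipschitz) polygonal domain: a bounded connected open set whose boundary is a disjoint
union of finitely many simple closed polygonal curves, given by its finite set of oriented straight
edges. Every edge is oriented such that the domain lies on its left, so `outNormal e` is the outward
unit normal. Two consecutive edges may lie on one line (hanging nodes are ordinary vertices). -/
structure PolygonalDomain where
  carrier : Set Plane
  edges : Finset (Plane × Plane)
  isOpen : IsOpen carrier
  isConnected : IsConnected carrier
  isBounded : Bornology.IsBounded carrier
  ne_of_mem : ∀ e ∈ edges, e.1 ≠ e.2
  inter_subset : ∀ e ∈ edges, ∀ e' ∈ edges, e ≠ e' →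
    segment ℝ e.1 e.2 ∩ segment ℝ e'.1 e'.2 ⊆ ({e.1, e.2} ∩ {e'.1, e'.2} : Set Plane)
  existsUnique_next : ∀ e ∈ edges, ∃! e', e' ∈ edges ∧ e'.1 = e.2
  existsUnique_prev : ∀ e ∈ edges, ∃! e', e' ∈ edges ∧ e'.2 = e.1
  frontier_eq : frontier carrier = ⋃ e ∈ edges, segment ℝ e.1 e.2
  left_mem : ∀ e ∈ edges, ∀ x ∈ openSegment ℝ e.1 e.2,
    ∀ᶠ t in 𝓝[>] (0 : ℝ), x - t • outNormal e ∈ carrier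
  right_notMem : ∀ e ∈ edges, ∀ x ∈ openSegment ℝ e.1 e.2,
    ∀ᶠ t in 𝓝[>] (0 : ℝ), x + t • outNormal e ∉ carrier

/-- `Γ_D`, `Γ_N` are disjoint with union the boundary of `Ω`, and `Γ_D` is not empty. -/
structure IsBoundarySplit (Ω : PolygonalDomain) (ΓD ΓN : Set Plane) : Prop where
  union_eq : ΓD ∪ ΓN = frontier Ω.carrier
  disjoint : Disjoint ΓD ΓN
  nonempty : ΓD.Nonempty

/-- A conforming decomposition of `Ω` into finitely many polygons. Every edge of an element either lies
inside `Ω` and is, with the opposite orientation, an edge of a neighbouring element, or it lies on the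
boundary of `Ω`. -/
structure Mesh (Ω : PolygonalDomain) where
  card : ℕ
  elem : Fin card → PolygonalDomain
  pairwise_disjoint : ∀ i j, i ≠ j → Disjoint (elem i).carrier (elem j).carrier
  subset : ∀ i, (elem i).carrier ⊆ Ω.carrier
  iUnion_closure : ⋃ i, closure (elem i).carrier = closure Ω.carrier
  conforming : ∀ i, ∀ e ∈ (elem i).edges,
    (openSegment ℝ e.1 e.2 ⊆ Ω.carrier ∧ ∃ j, (e.2, e.1) ∈ (elem j).edges) ∨
      segment ℝ e.1 e.2 ⊆ frontier Ω.carrier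

/-- The mesh is conforming with respect to the Dirichlet and the Neumann boundary: every boundary edge
lies (up to its end points) in `Γ_D` or in `Γ_N`. -/
def Mesh.ConformsTo {Ω : PolygonalDomain} (T : Mesh Ω) (ΓD ΓN : Set Plane) : Prop :=
  ∀ i, ∀ e ∈ (T.elem i).edges, segment ℝ e.1 e.2 ⊆ frontier Ω.carrier →
    openSegment ℝ e.1 e.2 ⊆ ΓD ∨ openSegment ℝ e.1 e.2 ⊆ ΓN

/-- Every element `K` is star-shaped with respect to a ball of radius at least `γ h_K`. -/
def Mesh.StarShaped {Ω : PolygonalDomain} (T : Mesh Ω) (γ : ℝ) : Prop :=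
  ∀ i, ∃ (c : Plane) (r : ℝ), γ * Metric.diam (T.elem i).carrier ≤ r ∧
    ∀ y ∈ Metric.ball c r, StarConvex ℝ y (T.elem i).carrier

/-- `h_K ≤ γ h_e` for every edge `e` of every element `K`. -/
def Mesh.EdgesComparable {Ω : PolygonalDomain} (T : Mesh Ω) (γ : ℝ) : Prop :=
  ∀ i, ∀ e ∈ (T.elem i).edges, Metric.diam (T.elem i).carrier ≤ γ * ‖e.2 - e.1‖

/-- `κ` is constant on every element. -/
def Mesh.PiecewiseConstant {Ω : PolygonalDomain} (T : Mesh Ω) (κ : Plane → ℝ) : Prop :=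
  ∀ i, ∃ c : ℝ, ∀ x ∈ (T.elem i).carrier, κ x = c

/-! ### Polynomials -/

/-- `P` has total degree `< d`; for `d = 0` this says `P = 0`. Thus `ℙ_ℓ` is `DegLT (ℓ + 1)`, and
`ℙ_{-1} = {0}`. -/
def DegLT (d : ℕ) (P : MvPolynomial (Fin 2) ℝ) : Prop :=
  ∀ m ∈ P.support, m.degree < d

/-- The polynomial function of `P` on the plane. -/
def pev (P : MvPolynomial (Fin 2) ℝ) (x : Plane) : ℝ :=
  MvPolynomial.eval (fun i => x i) P

/-- The gradient of the polynomial function of `P`. -/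
def pgrad (P : MvPolynomial (Fin 2) ℝ) (x : Plane) : Plane :=
  !₂[pev (MvPolynomial.pderiv 0 P) x, pev (MvPolynomial.pderiv 1 P) x]

/-- On the (relatively open) segment `e`, the function `g` is a polynomial of degree at most `d`. -/
def IsPolyOnEdge (d : ℕ) (e : Plane × Plane) (g : Plane → ℝ) : Prop :=
  ∃ q : Polynomial ℝ, q.natDegree ≤ d ∧
    ∀ t ∈ Set.Ioo (0 : ℝ) 1, g (AffineMap.lineMap e.1 e.2 t) = q.eval t

/-- `g` is piecewise a polynomial of degree at most `p` over `Γ`, the pieces being the edges of the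
mesh that lie in the part `Γ` of the boundary. -/
def Mesh.PiecewisePoly {Ω : PolygonalDomain} (T : Mesh Ω) (p : ℕ) (Γ : Set Plane) (g : Plane → ℝ) :
    Prop :=
  ∀ i, ∀ e ∈ (T.elem i).edges, openSegment ℝ e.1 e.2 ⊆ Γ → IsPolyOnEdge p e g

/-! ### Weak derivatives, `H¹`, `H(div)`, `H(rot)` -/

/-- The test functions of class `C_c^∞(U)`. -/
def IsTest (U : Set Plane) (φ : Plane → ℝ) : Prop :=
  ContDiff ℝ ∞ φ ∧ HasCompactSupport φ ∧ tsupport φ ⊆ U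

/-- `v ∈ L²(U)` has the weak gradient `G ∈ L²(U)²` in `U`. -/
structure HasWeakGrad (U : Set Plane) (v : Plane → ℝ) (G : Plane → Plane) : Prop where
  memLp : MemLp v 2 (volume.restrict U)
  memLp_grad : MemLp G 2 (volume.restrict U)
  integral_eq : ∀ φ, IsTest U φ → ∫ x in U, v x • gradient φ x = -∫ x in U, φ x • G x

/-- `τ ∈ L²(U)²` has the weak divergence `d ∈ L²(U)` in `U`. -/
structure HasWeakDiv (U : Set Plane) (τ : Plane → Plane) (d : Plane → ℝ) : Prop where
  memLp : MemLp τ 2 (volume.restrict U)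
  memLp_div : MemLp d 2 (volume.restrict U)
  integral_eq : ∀ φ, IsTest U φ → ∫ x in U, inner ℝ (τ x) (gradient φ x) = -∫ x in U, d x * φ x

/-- `τ ∈ L²(U)²` has the weak rotor `∂_y τ₁ - ∂_x τ₂ = r ∈ L²(U)` in `U`. -/
structure HasWeakRot (U : Set Plane) (τ : Plane → Plane) (r : Plane → ℝ) : Prop where
  memLp : MemLp τ 2 (volume.restrict U)
  memLp_rot : MemLp r 2 (volume.restrict U)
  integral_eq : ∀ φ, IsTest U φ →
    ∫ x in U, (τ x 0 * gradient φ x 1 - τ x 1 * gradient φ x 0) = -∫ x in U, r x * φ x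

/-- `v ∈ H¹(U)`. -/
def MemH1 (U : Set Plane) (v : Plane → ℝ) : Prop := ∃ G, HasWeakGrad U v G

/-- `τ ∈ H(div, U)`. -/
def MemHdiv (U : Set Plane) (τ : Plane → Plane) : Prop := ∃ d, HasWeakDiv U τ d

/-- The weak gradient on `U` of `v ∈ H¹(U)` (unique up to null sets in the open set `U`). -/
def weakGrad (U : Set Plane) (v : Plane → ℝ) : Plane → Plane :=
  Classical.epsilon (HasWeakGrad U v)

/-- The weak divergence on `U` of `τ ∈ H(div, U)` (unique up to null sets in the open set `U`). -/
def weakDiv (U : Set Plane) (τ : Plane → Plane) : Plane → ℝ :=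
  Classical.epsilon (HasWeakDiv U τ)

/-- The square of the `L²(U)` norm of a vector field. -/
def normSq (U : Set Plane) (F : Plane → Plane) : ℝ := ∫ x in U, ‖F x‖ ^ 2

/-! ### Traces

The boundary of a polygonal domain carries the length measure, i.e. the one-dimensional Hausdorff
measure `μH[1]`. -/

/-- `γ ∈ L²(∂Ω)` is the trace of `v ∈ H¹(Ω)`: `v` is the limit in `H¹(Ω)` of functions that are smooth
up to the boundary and whose restrictions to the boundary converge to `γ` in `L²(∂Ω)`. -/
def HasTrace (Ω : PolygonalDomain) (v γ : Plane → ℝ) : Prop :=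
  MemLp γ 2 ((μH[1] : Measure Plane).restrict (frontier Ω.carrier)) ∧
  ∃ φ : ℕ → Plane → ℝ, (∀ m, ContDiff ℝ ∞ (φ m)) ∧
    Tendsto (fun m => eLpNorm (fun x => φ m x - v x) 2 (volume.restrict Ω.carrier)) atTop (𝓝 0) ∧
    Tendsto (fun m => eLpNorm (fun x => gradient (φ m) x - weakGrad Ω.carrier v x) 2
      (volume.restrict Ω.carrier)) atTop (𝓝 0) ∧
    Tendsto (fun m => eLpNorm (fun x => φ m x - γ x) 2
      ((μH[1] : Measure Plane).restrict (frontier Ω.carrier))) atTop (𝓝 0)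

/-- `v ∈ H¹(Ω)`, with trace `γ` on the boundary, satisfies `v = g` on `Γ_D`. -/
structure MemPrimalSpace (Ω : PolygonalDomain) (ΓD : Set Plane) (g v γ : Plane → ℝ) : Prop where
  memH1 : MemH1 Ω.carrier v
  hasTrace : HasTrace Ω v γ
  eq_on : γ =ᵐ[(μH[1] : Measure Plane).restrict ΓD] g

/-- The duality pairing `⟨n · τ, v⟩` on the boundary of `Ω` of the normal trace (in `H^{-1/2}(∂Ω)`) of
`τ ∈ H(div, Ω)` with the trace (in `H^{1/2}(∂Ω)`) of `v ∈ H¹(Ω)`. -/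
def normalPairing (Ω : PolygonalDomain) (τ : Plane → Plane) (v : Plane → ℝ) : ℝ :=
  ∫ x in Ω.carrier, (inner ℝ (τ x) (weakGrad Ω.carrier v x) + weakDiv Ω.carrier τ x * v x)

/-- `τ ∈ H(div, Ω)` satisfies `n · τ = g` on `Γ_N`, as functionals on the traces of the functions of
`H¹(Ω)` that vanish on `Γ_D`. -/
structure MemFluxSpace (Ω : PolygonalDomain) (ΓD ΓN : Set Plane) (g : Plane → ℝ)
    (τ : Plane → Plane) : Prop where
  memHdiv : MemHdiv Ω.carrier τ
  normal_eq : ∀ v γ, MemPrimalSpace Ω ΓD (fun _ => 0) v γ →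
    normalPairing Ω τ v = ∫ x in ΓN, g x * γ x ∂(μH[1] : Measure Plane)

/-! ### The continuous problems -/

/-- `u` is a weak solution of `-div (κ ∇u) = f` in `Ω`, `u = g_D` on `Γ_D`, `n · (κ ∇u) = g_N` on
`Γ_N`. -/
structure IsPrimalSolution (Ω : PolygonalDomain) (ΓD ΓN : Set Plane) (κ f gD gN : Plane → ℝ)
    (u : Plane → ℝ) : Prop where
  mem : ∃ γ, MemPrimalSpace Ω ΓD gD u γ
  eq : ∀ v γ, MemPrimalSpace Ω ΓD (fun _ => 0) v γ →
    ∫ x in Ω.carrier, κ x * inner ℝ (weakGrad Ω.carrier u x) (weakGrad Ω.carrier v x) =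
      (∫ x in Ω.carrier, f x * v x) + ∫ x in ΓN, gN x * γ x ∂(μH[1] : Measure Plane)

/-- `(σ, u)` is a weak solution of the mixed formulation (with `σ = -κ ∇u`, so `n · σ = -g_N` on
`Γ_N`). For a flux `τ` with `n · τ = 0` on `Γ_N`, the pairing `(g_D, n · τ)` over `Γ_D` is the pairing of
`n · τ` with any lifting `w ∈ H¹(Ω)` of `g_D`. -/
structure IsMixedSolution (Ω : PolygonalDomain) (ΓD ΓN : Set Plane) (κ f gD gN : Plane → ℝ)
    (σ : Plane → Plane) (u : Plane → ℝ) : Prop where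
  mem : MemFluxSpace Ω ΓD ΓN (fun x => -gN x) σ
  memLp : MemLp u 2 (volume.restrict Ω.carrier)
  eq_flux : ∀ τ, MemFluxSpace Ω ΓD ΓN (fun _ => 0) τ → ∀ w γ, MemPrimalSpace Ω ΓD gD w γ →
    (∫ x in Ω.carrier, (κ x)⁻¹ * inner ℝ (σ x) (τ x))
      + -(∫ x in Ω.carrier, weakDiv Ω.carrier τ x * u x) = -normalPairing Ω τ w
  eq_div : ∀ v, MemLp v 2 (volume.restrict Ω.carrier) →
    -(∫ x in Ω.carrier, weakDiv Ω.carrier σ x * v x) = ∫ x in Ω.carrier, -f x * v x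

/-! ### The virtual element method for the primal formulation -/

/-- The local nodal virtual element space on `K`: functions in `H¹(K) ∩ C⁰(K̄)` that are polynomials of
degree at most `p` on each edge and have a weak Laplacian in `ℙ_{p-2}(K)`. -/
structure MemLocalPrimal (K : PolygonalDomain) (p : ℕ) (v : Plane → ℝ) : Prop where
  continuousOn : ContinuousOn v (closure K.carrier)
  poly_edge : ∀ e ∈ K.edges, IsPolyOnEdge p e v
  laplace : ∃ G Q, HasWeakGrad K.carrier v G ∧ DegLT (p - 1) Q ∧ HasWeakDiv K.carrier G (pev Q)

/-- `P ∈ ℙ_p(K)` is the `H¹` projection of `v`. -/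
structure IsPiNabla (K : PolygonalDomain) (κ : Plane → ℝ) (p : ℕ) (v : Plane → ℝ)
    (P : MvPolynomial (Fin 2) ℝ) : Prop where
  degLT : DegLT (p + 1) P
  orthogonal : ∀ Q, DegLT (p + 1) Q →
    ∫ x in K.carrier, κ x * inner ℝ (weakGrad K.carrier v x - pgrad P x) (pgrad Q x) = 0
  boundary : ∫ x in frontier K.carrier, (v x - pev P x) ∂(μH[1] : Measure Plane) = 0

/-- The `H¹` projector onto `ℙ_p(K)`. -/
def piNabla (K : PolygonalDomain) (κ : Plane → ℝ) (p : ℕ) (v : Plane → ℝ) :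
    MvPolynomial (Fin 2) ℝ :=
  Classical.epsilon (IsPiNabla K κ p v)

/-- `P`, of degree `< d`, is the `L²(K)` projection of `v`. -/
structure IsPiZero (K : PolygonalDomain) (d : ℕ) (v : Plane → ℝ)
    (P : MvPolynomial (Fin 2) ℝ) : Prop where
  degLT : DegLT d P
  orthogonal : ∀ Q, DegLT d Q → ∫ x in K.carrier, (v x - pev P x) * pev Q x = 0

/-- The `L²(K)` projector onto the polynomials of degree `< d`. -/
def piZero (K : PolygonalDomain) (d : ℕ) (v : Plane → ℝ) : MvPolynomial (Fin 2) ℝ :=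
  Classical.epsilon (IsPiZero K d v)

/-- `v` is in the kernel of the `H¹` projector of the local virtual element space. -/
structure MemKerPiNabla (K : PolygonalDomain) (κ : Plane → ℝ) (p : ℕ) (v : Plane → ℝ) : Prop where
  mem : MemLocalPrimal K p v
  proj : IsPiNabla K κ p v 0

/-- `S` is an admissible stabilization on `K` for the primal method: a bilinear form on the kernel of
the `H¹` projector (a function of the values on `K̄` only) such that
`αlo a^K(v,v) ≤ S(v,v) ≤ αhi a^K(v,v)` with `0 < αlo ≤ αhi`. -/
structure IsPrimalStab (K : PolygonalDomain) (κ : Plane → ℝ) (p : ℕ) (αlo αhi : ℝ)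
    (S : (Plane → ℝ) → (Plane → ℝ) → ℝ) : Prop where
  pos : 0 < αlo
  le : αlo ≤ αhi
  congr : ∀ v v' w w', MemKerPiNabla K κ p v → MemKerPiNabla K κ p v' →
    MemKerPiNabla K κ p w → MemKerPiNabla K κ p w' →
    Set.EqOn v v' (closure K.carrier) → Set.EqOn w w' (closure K.carrier) → S v w = S v' w'
  lin_left : ∀ (c : ℝ) v v' w, MemKerPiNabla K κ p v → MemKerPiNabla K κ p v' →
    MemKerPiNabla K κ p w → S (c • v + v') w = c * S v w + S v' w
  lin_right : ∀ (c : ℝ) v w w', MemKerPiNabla K κ p v → MemKerPiNabla K κ p w →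
    MemKerPiNabla K κ p w' → S v (c • w + w') = c * S v w + S v w'
  lower : ∀ v, MemKerPiNabla K κ p v →
    αlo * ∫ x in K.carrier, κ x * ‖weakGrad K.carrier v x‖ ^ 2 ≤ S v v
  upper : ∀ v, MemKerPiNabla K κ p v →
    S v v ≤ αhi * ∫ x in K.carrier, κ x * ‖weakGrad K.carrier v x‖ ^ 2

/-- `(I - Π^∇_p) v`. -/
def subPiNabla (K : PolygonalDomain) (κ : Plane → ℝ) (p : ℕ) (v : Plane → ℝ) : Plane → ℝ :=
  fun x => v x - pev (piNabla K κ p v) x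

/-- The local discrete bilinear form of the primal method. -/
def primalForm (K : PolygonalDomain) (κ : Plane → ℝ) (p : ℕ)
    (S : (Plane → ℝ) → (Plane → ℝ) → ℝ) (v w : Plane → ℝ) : ℝ :=
  (∫ x in K.carrier, κ x * inner ℝ (pgrad (piNabla K κ p v) x) (pgrad (piNabla K κ p w) x))
    + S (subPiNabla K κ p v) (subPiNabla K κ p w)

/-- The global virtual element space with `v = g` on the edges in `Γ_D`. -/
structure MemPrimalVEM {Ω : PolygonalDomain} (T : Mesh Ω) (ΓD : Set Plane) (p : ℕ)
    (g v : Plane → ℝ) : Prop where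
  continuousOn : ContinuousOn v (closure Ω.carrier)
  mem_local : ∀ i, MemLocalPrimal (T.elem i) p v
  dirichlet : ∀ i, ∀ e ∈ (T.elem i).edges, openSegment ℝ e.1 e.2 ⊆ ΓD →
    ∀ x ∈ openSegment ℝ e.1 e.2, v x = g x

/-- The discrete load `⟨f, v⟩_n`: for `p ≥ 2` the sum of the integrals of `f Π⁰_{p-2} v`; for `p = 1` the
sum of the integrals of `f` over the elements, times the mean of the values of `v` at the vertices. -/
def discreteLoad {Ω : PolygonalDomain} (T : Mesh Ω) (p : ℕ) (f v : Plane → ℝ) : ℝ :=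
  if p = 1 then
    ∑ i, (∫ x in (T.elem i).carrier, f x) *
      ((∑ e ∈ (T.elem i).edges, v e.1) / ((T.elem i).edges.card : ℝ))
  else
    ∑ i, ∫ x in (T.elem i).carrier, f x * pev (piZero (T.elem i) (p - 1) v) x

/-- `u` solves the primal virtual element method. -/
structure IsPrimalVEMSolution {Ω : PolygonalDomain} (T : Mesh Ω) (ΓD ΓN : Set Plane)
    (κ f gD gN : Plane → ℝ) (p : ℕ) (S : Fin T.card → (Plane → ℝ) → (Plane → ℝ) → ℝ)
    (u : Plane → ℝ) : Prop where
  mem : MemPrimalVEM T ΓD p gD u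
  eq : ∀ v, MemPrimalVEM T ΓD p (fun _ => 0) v →
    ∑ i, primalForm (T.elem i) κ p (S i) u v =
      discreteLoad T p f v + ∫ x in ΓN, gN x * v x ∂(μH[1] : Measure Plane)

/-! ### The virtual element method for the mixed formulation -/

/-- The classical divergence of a smooth vector field. -/
def divergence (Φ : Plane → Plane) (x : Plane) : ℝ :=
  ∑ i : Fin 2, fderiv ℝ Φ x (EuclideanSpace.single i 1) i

/-- The outward normal trace of `τ ∈ H(div, K)` is the function `ψ` on the boundary of `K`: `τ` is the
limit in `H(div, K)` of vector fields that are smooth up to the boundary and whose normal components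
converge to `ψ` in the sense of distributions on the boundary. -/
def HasNormalTrace (K : PolygonalDomain) (τ : Plane → Plane) (ψ : Plane → ℝ) : Prop :=
  MemHdiv K.carrier τ ∧
  ∃ Φ : ℕ → Plane → Plane, (∀ m, ContDiff ℝ ∞ (Φ m)) ∧
    Tendsto (fun m => eLpNorm (fun x => Φ m x - τ x) 2 (volume.restrict K.carrier)) atTop (𝓝 0) ∧
    Tendsto (fun m => eLpNorm (fun x => divergence (Φ m) x - weakDiv K.carrier τ x) 2
      (volume.restrict K.carrier)) atTop (𝓝 0) ∧
    ∀ φ : Plane → ℝ, ContDiff ℝ ∞ φ →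
      Tendsto (fun m => ∑ e ∈ K.edges, ∫ x in segment ℝ e.1 e.2,
          inner ℝ (Φ m x) (outNormal e) * φ x ∂(μH[1] : Measure Plane)) atTop
        (𝓝 (∑ e ∈ K.edges, ∫ x in segment ℝ e.1 e.2, ψ x * φ x ∂(μH[1] : Measure Plane)))

/-- `τ`, with outward normal trace `ψ` on the boundary of `K`, is in the local flux space: `n · τ` is a
polynomial of degree at most `p` on each edge, and `div τ` and `rot τ` are in `ℙ_{p-1}(K)`. -/
structure MemLocalFlux (K : PolygonalDomain) (p : ℕ) (τ : Plane → Plane) (ψ : Plane → ℝ) :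
    Prop where
  hasNormalTrace : HasNormalTrace K τ ψ
  poly_edge : ∀ e ∈ K.edges, IsPolyOnEdge p e ψ
  div_poly : ∃ Q, DegLT p Q ∧ HasWeakDiv K.carrier τ (pev Q)
  rot_poly : ∃ Q, DegLT p Q ∧ HasWeakRot K.carrier τ (pev Q)

/-- `∇R`, with `R ∈ ℙ_{p+1}(K)`, is the projection of `τ` onto `∇ ℙ_{p+1}(K)`. -/
structure IsPiFlux (K : PolygonalDomain) (κ : Plane → ℝ) (p : ℕ) (τ : Plane → Plane)
    (R : MvPolynomial (Fin 2) ℝ) : Prop where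
  degLT : DegLT (p + 2) R
  orthogonal : ∀ Q, DegLT (p + 2) Q →
    ∫ x in K.carrier, (κ x)⁻¹ * inner ℝ (τ x - pgrad R x) (pgrad Q x) = 0

/-- The projector `Π⁰_p` onto `∇ ℙ_{p+1}(K)`. -/
def piFlux (K : PolygonalDomain) (κ : Plane → ℝ) (p : ℕ) (τ : Plane → Plane) : Plane → Plane :=
  pgrad (Classical.epsilon (IsPiFlux K κ p τ))

/-- `τ` is in the kernel of the projector `Π⁰_p` of the local flux space. -/
structure MemKerPiFlux (K : PolygonalDomain) (κ : Plane → ℝ) (p : ℕ) (τ : Plane → Plane) :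
    Prop where
  mem : ∃ ψ, MemLocalFlux K p τ ψ
  proj : IsPiFlux K κ p τ 0

/-- `S` is an admissible stabilization on `K` for the mixed method: a bilinear form on the kernel of
`Π⁰_p` (a function of the restrictions to `K` only) such that
`αlo a^K(τ,τ) ≤ S(τ,τ) ≤ αhi a^K(τ,τ)` with `0 < αlo ≤ αhi`. -/
structure IsMixedStab (K : PolygonalDomain) (κ : Plane → ℝ) (p : ℕ) (αlo αhi : ℝ)
    (S : (Plane → Plane) → (Plane → Plane) → ℝ) : Prop where
  pos : 0 < αlo
  le : αlo ≤ αhi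
  congr : ∀ σ σ' τ τ', MemKerPiFlux K κ p σ → MemKerPiFlux K κ p σ' →
    MemKerPiFlux K κ p τ → MemKerPiFlux K κ p τ' →
    σ =ᵐ[volume.restrict K.carrier] σ' → τ =ᵐ[volume.restrict K.carrier] τ' → S σ τ = S σ' τ'
  lin_left : ∀ (c : ℝ) σ σ' τ, MemKerPiFlux K κ p σ → MemKerPiFlux K κ p σ' →
    MemKerPiFlux K κ p τ → S (c • σ + σ') τ = c * S σ τ + S σ' τ
  lin_right : ∀ (c : ℝ) σ τ τ', MemKerPiFlux K κ p σ → MemKerPiFlux K κ p τ →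
    MemKerPiFlux K κ p τ' → S σ (c • τ + τ') = c * S σ τ + S σ τ'
  lower : ∀ τ, MemKerPiFlux K κ p τ →
    αlo * ∫ x in K.carrier, (κ x)⁻¹ * ‖τ x‖ ^ 2 ≤ S τ τ
  upper : ∀ τ, MemKerPiFlux K κ p τ →
    S τ τ ≤ αhi * ∫ x in K.carrier, (κ x)⁻¹ * ‖τ x‖ ^ 2

/-- `(I - Π⁰_p) τ`. -/
def subPiFlux (K : PolygonalDomain) (κ : Plane → ℝ) (p : ℕ) (τ : Plane → Plane) : Plane → Plane :=
  fun x => τ x - piFlux K κ p τ x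

/-- The local discrete bilinear form of the mixed method. -/
def mixedForm (K : PolygonalDomain) (κ : Plane → ℝ) (p : ℕ)
    (S : (Plane → Plane) → (Plane → Plane) → ℝ) (σ τ : Plane → Plane) : ℝ :=
  (∫ x in K.carrier, (κ x)⁻¹ * inner ℝ (piFlux K κ p σ x) (piFlux K κ p τ x))
    + S (subPiFlux K κ p σ) (subPiFlux K κ p τ)

/-- The global flux space with `n · τ = g` on the edges in `Γ_N`; `ψ i` is the outward normal trace of
`τ` on the boundary of the element `i`, and the normal components have no jump. -/
structure MemFluxVEM {Ω : PolygonalDomain} (T : Mesh Ω) (ΓN : Set Plane) (p : ℕ) (g : Plane → ℝ)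
    (τ : Plane → Plane) (ψ : Fin T.card → Plane → ℝ) : Prop where
  memHdiv : MemHdiv Ω.carrier τ
  mem_local : ∀ i, MemLocalFlux (T.elem i) p τ (ψ i)
  jump : ∀ i j, ∀ e ∈ (T.elem i).edges, (e.2, e.1) ∈ (T.elem j).edges →
    ∀ x ∈ openSegment ℝ e.1 e.2, ψ i x + ψ j x = 0
  neumann : ∀ i, ∀ e ∈ (T.elem i).edges, openSegment ℝ e.1 e.2 ⊆ ΓN →
    ∀ x ∈ openSegment ℝ e.1 e.2, ψ i x = g x

/-- Piecewise polynomials of degree at most `p - 1` over the mesh (for `p ≥ 1`), without continuity. -/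
def MemScalarVEM {Ω : PolygonalDomain} (T : Mesh Ω) (p : ℕ) (v : Plane → ℝ) : Prop :=
  ∀ i, ∃ Q, DegLT p Q ∧ ∀ x ∈ (T.elem i).carrier, v x = pev Q x

open Classical in
/-- The integral `(g, n · τ)` over `Γ_D`, where `ψ i` is the outward normal trace of `τ` on the boundary
of the element `i`. -/
def dirichletPairing {Ω : PolygonalDomain} (T : Mesh Ω) (ΓD : Set Plane) (g : Plane → ℝ)
    (ψ : Fin T.card → Plane → ℝ) : ℝ :=
  ∑ i, ∑ e ∈ (T.elem i).edges with openSegment ℝ e.1 e.2 ⊆ ΓD,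
    ∫ x in segment ℝ e.1 e.2, g x * ψ i x ∂(μH[1] : Measure Plane)

/-- `(σ, u)` solves the mixed virtual element method. -/
structure IsMixedVEMSolution {Ω : PolygonalDomain} (T : Mesh Ω) (ΓD ΓN : Set Plane)
    (κ f gD gN : Plane → ℝ) (p : ℕ) (S : Fin T.card → (Plane → Plane) → (Plane → Plane) → ℝ)
    (σ : Plane → Plane) (u : Plane → ℝ) : Prop where
  mem_flux : ∃ ψ, MemFluxVEM T ΓN p (fun x => -gN x) σ ψ
  mem_scalar : MemScalarVEM T p u
  eq_flux : ∀ τ ψ, MemFluxVEM T ΓN p (fun _ => 0) τ ψ →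
    (∑ i, mixedForm (T.elem i) κ p (S i) σ τ)
      + -(∫ x in Ω.carrier, weakDiv Ω.carrier τ x * u x) = -dirichletPairing T ΓD gD ψ
  eq_div : ∀ v, MemScalarVEM T p v →
    -(∫ x in Ω.carrier, weakDiv Ω.carrier σ x * v x) = ∫ x in Ω.carrier, -f x * v x

/-! ### The local equilibrated error estimator -/

/-- The square of the local equilibrated error estimator on `K` of the discrete solutions `u` (primal
method) and `σ` (mixed method), for the stabilizations `S` (primal) and `S'` (mixed). -/
def etaSq (K : PolygonalDomain) (κ : Plane → ℝ) (p : ℕ)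
    (S : (Plane → ℝ) → (Plane → ℝ) → ℝ) (S' : (Plane → Plane) → (Plane → Plane) → ℝ)
    (u : Plane → ℝ) (σ : Plane → Plane) : ℝ :=
  normSq K.carrier (fun x =>
      √(κ x) • pgrad (piNabla K κ p u) x + (√(κ x))⁻¹ • piFlux K κ p σ x)
    + (S (subPiNabla K κ p u) (subPiNabla K κ p u) + S' (subPiFlux K κ p σ) (subPiFlux K κ p σ))

end

end HypercircleVEM

open HypercircleVEM

namespace HypercircleVEM

/-! The two continuous problems have the same flux, `σ = -κ ∇ũ` almost everywhere
(`IsMixedSolution.ae_eq_neg_smul_weakGrad`). To see this, put `τ = σ + κ ∇ũ`. Both `σ` and `-κ ∇ũ`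
have divergence `f`, and their normal components on `Γ_N` agree, so `τ` is divergence free and an
admissible test flux. In the first mixed equation the boundary datum may be lifted by `ũ` itself,
which gives `(κ⁻¹σ, τ) = -(τ, ∇ũ)`, that is `∫ κ⁻¹ |τ|² = 0`.

On an element write `y = ∇ũ_n` and `P = ∇Π^∇_p ũ_n`. Since `κ^{1/2} ∇ũ + κ^{-1/2} σ = 0`, the first
term of the estimator is the norm of `κ^{1/2}(∇ũ - P) + κ^{-1/2}(σ - Π⁰_p σ_n)`, and the factor 2
from squaring a sum separates a primal from a mixed error. The stabilization terms are bounded by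
`‖y - P‖²`, its mixed analogue, and the upper stabilization constants.

An arbitrary polynomial gradient `q` enters through orthogonality alone
(`normSq_sub_le_of_orthogonal`). If `y - P ⟂ q - P`, then `‖x - P‖² ≤ ‖x - y‖² + ‖x - q‖²` and `‖y -
P‖² ≤ 2(‖x - y‖² + ‖x - q‖²)` for every `x`. With `x = ∇ũ`, and likewise for the fluxes, `etaSq_le`
follows; the bound with the projections is the case where `q` and `r` are the projections.

The rest makes this applicable. The projectors are defined by `Classical.epsilon`, so projections
must be shown to exist; the stabilization bounds hold on the kernels only, so `(I - Π)v` must be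
shown to lie there, and in particular the polynomials (for the flux, polynomial gradients) must
belong to the local spaces. -/

/-! ### Smooth functions: classical derivatives are weak derivatives. -/

/-- Since `φ` vanishes outside a compact subset of `U`, both integrals extend to the whole plane,
where integration by parts has no boundary term. -/
lemma IsTest.integral_mul_fderiv {U : Set Plane} {φ g : Plane → ℝ} (hφ : IsTest U φ)
    (hg : ContDiff ℝ ∞ g) (e : Plane) :
    ∫ x in U, g x * fderiv ℝ φ x e = -∫ x in U, fderiv ℝ g x e * φ x := by
  obtain ⟨h1, h2, h3⟩ := hφ
  have hc : Continuous fun x => fderiv ℝ φ x e :=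
    (h1.continuous_fderiv (by simp)).clm_apply continuous_const
  have hcg : Continuous fun x => fderiv ℝ g x e :=
    (hg.continuous_fderiv (by simp)).clm_apply continuous_const
  have hs : HasCompactSupport fun x => fderiv ℝ φ x e := h2.fderiv_apply (𝕜 := ℝ) e
  have e1 : ∫ x in U, g x * fderiv ℝ φ x e = ∫ x, g x * fderiv ℝ φ x e := by
    refine setIntegral_eq_integral_of_forall_compl_eq_zero fun x hx => ?_
    have : fderiv ℝ φ x = 0 := by
      by_contra h
      exact hx (h3 (support_fderiv_subset ℝ h))
    simp [this]
  have e2 : ∫ x in U, fderiv ℝ g x e * φ x = ∫ x, fderiv ℝ g x e * φ x := by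
    refine setIntegral_eq_integral_of_forall_compl_eq_zero fun x hx => ?_
    rw [image_eq_zero_of_notMem_tsupport fun h => hx (h3 h), mul_zero]
  rw [e1, e2]
  refine integral_mul_fderiv_eq_neg_fderiv_mul_of_integrable ?_ ?_ ?_
    (fun x _ => (hg.differentiable (by simp)).differentiableAt)
    (fun x _ => (h1.differentiable (by simp)).differentiableAt)
  · exact (hcg.mul h1.continuous).integrable_of_hasCompactSupport h2.mul_left
  · exact (hg.continuous.mul hc).integrable_of_hasCompactSupport hs.mul_left
  · exact (hg.continuous.mul h1.continuous).integrable_of_hasCompactSupport h2.mul_left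

lemma memLp_of_continuousOn_closure {F : Type*} [NormedAddCommGroup F] {U : Set Plane}
    (hU : IsOpen U) (hb : Bornology.IsBounded U) {g : Plane → F}
    (hg : ContinuousOn g (closure U)) : MemLp g 2 (volume.restrict U) := by
  have hc : IsCompact (closure U) := hb.isCompact_closure
  have hfin : IsFiniteMeasure (volume.restrict U) :=
    ⟨by simpa using hb.measure_lt_top⟩
  obtain ⟨C, hC⟩ := hc.exists_bound_of_continuousOn hg
  refine MemLp.of_bound ?_ C ?_
  · exact ((hg.mono subset_closure).aestronglyMeasurable_of_isSeparable hU.measurableSet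
      (TopologicalSpace.IsSeparable.of_separableSpace U))
  · exact (ae_restrict_iff' hU.measurableSet).2 (.of_forall fun x hx => hC x (subset_closure hx))

lemma continuous_gradient {g : Plane → ℝ} (hg : ContDiff ℝ ∞ g) : Continuous (gradient g) :=
  (InnerProductSpace.toDual ℝ Plane).symm.continuous.comp (hg.continuous_fderiv (by simp))

lemma inner_gradient (g : Plane → ℝ) (x y : Plane) :
    inner ℝ (gradient g x) y = fderiv ℝ g x y := by
  simp [gradient]

lemma gradient_apply (g : Plane → ℝ) (x : Plane) (i : Fin 2) :
    gradient g x i = fderiv ℝ g x (EuclideanSpace.single i 1) := by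
  rw [← inner_gradient, EuclideanSpace.inner_single_right]
  simp

lemma fderiv_coord {Φ : Plane → Plane} (hΦ : ContDiff ℝ ∞ Φ) (x e : Plane) (i : Fin 2) :
    fderiv ℝ (fun y => Φ y i) x e = fderiv ℝ Φ x e i := by
  have h : HasFDerivAt Φ (fderiv ℝ Φ x) x := (hΦ.differentiable (by simp) x).hasFDerivAt
  have := ((EuclideanSpace.proj i : Plane →L[ℝ] ℝ).hasFDerivAt (x := Φ x)).comp x h
  rw [show (fun y => Φ y i) = (EuclideanSpace.proj i : Plane →L[ℝ] ℝ) ∘ Φ from rfl, this.fderiv]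
  rfl

lemma contDiff_coord {Φ : Plane → Plane} (hΦ : ContDiff ℝ ∞ Φ) (i : Fin 2) :
    ContDiff ℝ ∞ fun y => Φ y i :=
  (EuclideanSpace.proj i : Plane →L[ℝ] ℝ).contDiff.comp hΦ

lemma continuous_divergence {Φ : Plane → Plane} (hΦ : ContDiff ℝ ∞ Φ) :
    Continuous (divergence Φ) := by
  refine continuous_finsetSum _ fun i _ => ?_
  simp_rw [← fderiv_coord hΦ]
  exact ((contDiff_coord hΦ i).continuous_fderiv (by simp)).clm_apply continuous_const

lemma IsTest.memLp {U : Set Plane} {φ : Plane → ℝ} (hφ : IsTest U φ) :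
    MemLp φ 2 (volume.restrict U) :=
  (hφ.1.continuous.memLp_of_hasCompactSupport hφ.2.1).restrict U

lemma IsTest.memLp_gradient {U : Set Plane} {φ : Plane → ℝ} (hφ : IsTest U φ) :
    MemLp (gradient φ) 2 (volume.restrict U) := by
  refine ((continuous_gradient hφ.1).memLp_of_hasCompactSupport ?_).restrict U
  have : HasCompactSupport (fderiv ℝ φ) := hφ.2.1.fderiv (𝕜 := ℝ)
  exact this.comp_left (map_zero (InnerProductSpace.toDual ℝ Plane).symm)

lemma integrable_inner_of_memLp {G H : Plane → Plane} {μ : Measure Plane} (hG : MemLp G 2 μ)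
    (hH : MemLp H 2 μ) : Integrable (fun x => inner ℝ (G x) (H x)) μ := by
  refine (L2.integrable_inner (𝕜 := ℝ) (hG.toLp G) (hH.toLp H)).congr ?_
  filter_upwards [hG.coeFn_toLp, hH.coeFn_toLp] with x h1 h2
  rw [h1, h2]

lemma integrable_smul_of_memLp {v : Plane → ℝ} {H : Plane → Plane} {μ : Measure Plane}
    (hv : MemLp v 2 μ) (hH : MemLp H 2 μ) : Integrable (fun x => v x • H x) μ :=
  memLp_one_iff_integrable.1 (hH.smul hv)

lemma hasWeakGrad_gradient {U : Set Plane} (hU : IsOpen U)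
    (hb : Bornology.IsBounded U) {g : Plane → ℝ} (hg : ContDiff ℝ ∞ g) :
    HasWeakGrad U g (gradient g) := by
  have h1 := memLp_of_continuousOn_closure hU hb hg.continuous.continuousOn
  have h2 := memLp_of_continuousOn_closure hU hb (continuous_gradient hg).continuousOn
  refine ⟨h1, h2, fun φ hφ => ?_⟩
  refine ext_inner_right ℝ fun e => ?_
  rw [inner_neg_left, real_inner_comm, real_inner_comm e,
    ← integral_inner (integrable_smul_of_memLp h1 hφ.memLp_gradient),
    ← integral_inner (integrable_smul_of_memLp hφ.memLp h2)]
  have := hφ.integral_mul_fderiv hg e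
  simpa [inner_smul_right, real_inner_comm, inner_gradient, mul_comm] using this

lemma hasWeakDiv_divergence {U : Set Plane} (hU : IsOpen U)
    (hb : Bornology.IsBounded U) {Φ : Plane → Plane} (hΦ : ContDiff ℝ ∞ Φ) :
    HasWeakDiv U Φ (divergence Φ) := by
  have h1 := memLp_of_continuousOn_closure hU hb hΦ.continuous.continuousOn
  have h2 := memLp_of_continuousOn_closure hU hb (continuous_divergence hΦ).continuousOn
  refine ⟨h1, h2, fun φ hφ => ?_⟩
  have hc : ∀ i, MemLp (fun x => Φ x i) 2 (volume.restrict U) := fun i =>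
    memLp_of_continuousOn_closure hU hb (contDiff_coord hΦ i).continuous.continuousOn
  have hg : ∀ i, MemLp (fun x => gradient φ x i) 2 (volume.restrict U) := fun i =>
    hφ.memLp_gradient.continuousLinearMap_comp (EuclideanSpace.proj i : Plane →L[ℝ] ℝ)
  have hd : ∀ i, MemLp (fun x => fderiv ℝ Φ x (EuclideanSpace.single i 1) i) 2
      (volume.restrict U) := fun i => by
    simp_rw [← fderiv_coord hΦ]
    exact memLp_of_continuousOn_closure hU hb
      (((contDiff_coord hΦ i).continuous_fderiv (by simp)).clm_apply
        continuous_const).continuousOn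
  have e1 : ∀ i, ∫ x in U, Φ x i * gradient φ x i =
      -∫ x in U, fderiv ℝ Φ x (EuclideanSpace.single i 1) i * φ x := fun i => by
    simp_rw [gradient_apply, ← fderiv_coord hΦ]
    exact hφ.integral_mul_fderiv (contDiff_coord hΦ i) _
  simp only [PiLp.inner_apply, divergence, Finset.sum_mul]
  rw [integral_finsetSum, integral_finsetSum, ← Finset.sum_neg_distrib]
  · refine Finset.sum_congr rfl fun i _ => ?_
    rw [← e1]
    simp [mul_comm]
  · exact fun i _ => (hd i).integrable_mul hφ.memLp
  · exact fun i _ => ((hg i).integrable_mul (hc i)).congr (.of_forall fun x => by simp)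

/-- After integration by parts the two terms are mixed second derivatives of `g`, which cancel by
symmetry. -/
lemma hasWeakRot_gradient {U : Set Plane} (hU : IsOpen U)
    (hb : Bornology.IsBounded U) {g : Plane → ℝ} (hg : ContDiff ℝ ∞ g) :
    HasWeakRot U (gradient g) (fun _ => 0) := by
  have h2 := memLp_of_continuousOn_closure hU hb (continuous_gradient hg).continuousOn
  refine ⟨h2, MemLp.zero', fun φ hφ => ?_⟩
  have hg' : ∀ i, ContDiff ℝ ∞ fun x => gradient g x i := fun i => by
    simp_rw [gradient_apply]
    exact (hg.fderiv_right (by simp)).clm_apply contDiff_const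
  have hl : ∀ i, MemLp (fun x => gradient g x i) 2 (volume.restrict U) := fun i =>
    memLp_of_continuousOn_closure hU hb (hg' i).continuous.continuousOn
  have hφ' : ∀ i, MemLp (fun x => gradient φ x i) 2 (volume.restrict U) := fun i =>
    hφ.memLp_gradient.continuousLinearMap_comp (EuclideanSpace.proj i : Plane →L[ℝ] ℝ)
  have e : ∀ i j, ∫ x in U, gradient g x i * gradient φ x j =
      -∫ x in U, fderiv ℝ (fun y => gradient g y i) x (EuclideanSpace.single j 1) * φ x :=
    fun i j => by
      simp_rw [gradient_apply φ]
      exact hφ.integral_mul_fderiv (hg' i) _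
  have hsymm : ∀ x, fderiv ℝ (fun y => gradient g y 0) x (EuclideanSpace.single 1 1) =
      fderiv ℝ (fun y => gradient g y 1) x (EuclideanSpace.single 0 1) := fun x => by
    have hd : DifferentiableAt ℝ (fderiv ℝ g) x :=
      (hg.fderiv_right (m := ∞) (by simp)).differentiable (by simp) x
    have hs : IsSymmSndFDerivAt ℝ g x :=
      hg.contDiffAt.isSymmSndFDerivAt (by simp; exact WithTop.coe_le_coe.2 le_top)
    simp_rw [gradient_apply]
    rw [fderiv_clm_apply hd (differentiableAt_const _),
      fderiv_clm_apply hd (differentiableAt_const _)]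
    simpa using hs _ _
  have := integral_sub ((hl 0).integrable_mul (hφ' 1)) ((hl 1).integrable_mul (hφ' 0))
  simp only [Pi.mul_apply, e, hsymm, sub_self] at this
  simpa using this

/-! ### Polynomials: calculus, degree bounds and restriction to edges. -/

lemma pev_C (c : ℝ) : pev (MvPolynomial.C c) = fun _ => c := by
  ext; simp [pev]

lemma pev_add (P Q : MvPolynomial (Fin 2) ℝ) : pev (P + Q) = fun x => pev P x + pev Q x := by
  ext; simp [pev]

lemma pev_mul (P Q : MvPolynomial (Fin 2) ℝ) : pev (P * Q) = fun x => pev P x * pev Q x := by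
  ext; simp [pev]

lemma pev_X (i : Fin 2) : pev (MvPolynomial.X i) = fun x => x i := by
  ext; simp [pev]

lemma hasFDerivAt_pev (P : MvPolynomial (Fin 2) ℝ) (x : Plane) :
    HasFDerivAt (pev P) (∑ i : Fin 2, pev (MvPolynomial.pderiv i P) x •
      (EuclideanSpace.proj i : Plane →L[ℝ] ℝ)) x := by
  induction P using MvPolynomial.induction_on with
  | C a =>
    rw [pev_C]
    refine (hasFDerivAt_const a x).congr_fderiv ?_
    simp [pev]
  | add P Q hP hQ =>
    rw [pev_add]
    refine (hP.add hQ).congr_fderiv ?_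
    simp only [map_add, pev_add, add_smul, Finset.sum_add_distrib]
  | mul_X P n hP =>
    have hX : HasFDerivAt (fun y : Plane => y n) (EuclideanSpace.proj n : Plane →L[ℝ] ℝ) x :=
      (EuclideanSpace.proj n : Plane →L[ℝ] ℝ).hasFDerivAt
    rw [pev_mul, pev_X]
    refine (hP.mul hX).congr_fderiv ?_
    ext y
    fin_cases n <;> simp [Derivation.leibniz, pev, MvPolynomial.pderiv_X, Pi.single_apply] <;> ring

lemma contDiff_pev (P : MvPolynomial (Fin 2) ℝ) : ContDiff ℝ ∞ (pev P) := by
  induction P using MvPolynomial.induction_on with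
  | C a => rw [pev_C]; exact contDiff_const
  | add P Q hP hQ => rw [pev_add]; exact hP.add hQ
  | mul_X P n hP =>
    rw [pev_mul, pev_X]
    exact hP.mul (EuclideanSpace.proj n : Plane →L[ℝ] ℝ).contDiff

lemma fderiv_pev_single (P : MvPolynomial (Fin 2) ℝ) (x : Plane) (i : Fin 2) :
    fderiv ℝ (pev P) x (EuclideanSpace.single i 1) = pev (MvPolynomial.pderiv i P) x := by
  rw [(hasFDerivAt_pev P x).fderiv]
  fin_cases i <;> simp

lemma pgrad_apply (P : MvPolynomial (Fin 2) ℝ) (x : Plane) (i : Fin 2) :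
    pgrad P x i = pev (MvPolynomial.pderiv i P) x := by
  fin_cases i <;> simp [pgrad]

lemma gradient_pev (P : MvPolynomial (Fin 2) ℝ) : gradient (pev P) = pgrad P := by
  ext x i
  rw [gradient_apply, fderiv_pev_single, pgrad_apply]

lemma contDiff_pgrad (P : MvPolynomial (Fin 2) ℝ) : ContDiff ℝ ∞ (pgrad P) := by
  rw [contDiff_euclidean]
  intro i
  simp_rw [pgrad_apply]
  exact contDiff_pev _

/-- The Laplacian of a polynomial. -/
noncomputable def plaplace (P : MvPolynomial (Fin 2) ℝ) : MvPolynomial (Fin 2) ℝ :=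
  ∑ i : Fin 2, MvPolynomial.pderiv i (MvPolynomial.pderiv i P)

lemma divergence_pgrad (P : MvPolynomial (Fin 2) ℝ) :
    divergence (pgrad P) = pev (plaplace P) := by
  ext x
  simp only [divergence, ← fderiv_coord (contDiff_pgrad P), pgrad_apply, plaplace,
    fderiv_pev_single, Fin.sum_univ_two, pev_add]

lemma pgrad_sub (P Q : MvPolynomial (Fin 2) ℝ) (x : Plane) :
    pgrad (P - Q) x = pgrad P x - pgrad Q x := by
  ext i
  simp [pgrad_apply, pev]

lemma pgrad_add (P Q : MvPolynomial (Fin 2) ℝ) (x : Plane) :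
    pgrad (P + Q) x = pgrad P x + pgrad Q x := by
  ext i
  simp [pgrad_apply, pev]

lemma pgrad_smul (c : ℝ) (P : MvPolynomial (Fin 2) ℝ) (x : Plane) :
    pgrad (c • P) x = c • pgrad P x := by
  ext i
  simp [pgrad_apply, pev, MvPolynomial.smul_eval]

lemma pgrad_C (c : ℝ) (x : Plane) : pgrad (MvPolynomial.C c) x = 0 := by
  ext i
  simp [pgrad_apply, pev]

lemma pgrad_zero (x : Plane) : pgrad 0 x = 0 := by
  simpa using pgrad_C 0 x

/-- The polynomials of degree `< d` as a subspace. -/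
noncomputable def degLTSubmodule (d : ℕ) : Submodule ℝ (MvPolynomial (Fin 2) ℝ) :=
  MvPolynomial.restrictSupport ℝ {m | m.degree < d}

instance (d : ℕ) : Module.Finite ℝ (degLTSubmodule d) := by
  have : {m : Fin 2 →₀ ℕ | m.degree < d}.Finite := by
    exact (Finsupp.finite_of_degree_le (σ := Fin 2) d).subset
      fun m (hm : m.degree < d) => hm.le
  have : Finite {m : Fin 2 →₀ ℕ | m.degree < d} := this
  exact Module.Finite.of_basis (MvPolynomial.basisRestrictSupport ℝ _)

lemma DegLT.sub {d : ℕ} {P Q : MvPolynomial (Fin 2) ℝ} (hP : DegLT d P) (hQ : DegLT d Q) :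
    DegLT d (P - Q) :=
  (degLTSubmodule d).sub_mem hP hQ

lemma DegLT.add {d : ℕ} {P Q : MvPolynomial (Fin 2) ℝ} (hP : DegLT d P) (hQ : DegLT d Q) :
    DegLT d (P + Q) :=
  (degLTSubmodule d).add_mem hP hQ

lemma degLT_zero (d : ℕ) : DegLT d 0 :=
  (degLTSubmodule d).zero_mem

lemma degLT_C {d : ℕ} (hd : 0 < d) (c : ℝ) : DegLT d (MvPolynomial.C c) := fun m hm => by
  classical
  rw [MvPolynomial.mem_support_iff, MvPolynomial.coeff_C] at hm
  have : m = 0 := by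
    by_contra h
    exact hm (if_neg (Ne.symm h))
  simpa [this] using hd

/-- The truncated subtraction is harmless: a monomial of the derivative comes from one of degree one
higher, so for `d = 0` there is none. -/
lemma DegLT.pderiv {d : ℕ} {P : MvPolynomial (Fin 2) ℝ} (hP : DegLT d P) (i : Fin 2) :
    DegLT (d - 1) (MvPolynomial.pderiv i P) := fun m hm => by
  rw [MvPolynomial.mem_support_iff, MvPolynomial.coeff_pderiv] at hm
  have := hP (m + Finsupp.single i 1) (MvPolynomial.mem_support_iff.2 (left_ne_zero_of_mul hm))
  rw [map_add, Finsupp.degree_single] at this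
  omega

lemma DegLT.plaplace {d : ℕ} {P : MvPolynomial (Fin 2) ℝ} (hP : DegLT d P) :
    DegLT (d - 2) (HypercircleVEM.plaplace P) :=
  (degLTSubmodule (d - 2)).sum_mem (t := Finset.univ) fun i _ => (hP.pderiv i).pderiv i

lemma eval_aeval (t : ℝ) (f : Fin 2 → Polynomial ℝ) (P : MvPolynomial (Fin 2) ℝ) :
    (MvPolynomial.aeval f P).eval t = MvPolynomial.eval (fun i => (f i).eval t) P := by
  induction P using MvPolynomial.induction_on with
  | C a => simp
  | add P Q hP hQ => simp [hP, hQ]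
  | mul_X P n hP => simp [hP]

/-- An edge is parametrized by affine functions of `t`, and substituting them does not raise the
degree. -/
lemma DegLT.isPolyOnEdge {d : ℕ} {P : MvPolynomial (Fin 2) ℝ} (hP : DegLT (d + 1) P)
    (e : Plane × Plane) : IsPolyOnEdge d e (pev P) := by
  refine ⟨MvPolynomial.aeval (fun i => Polynomial.C (e.2 i - e.1 i) * Polynomial.X +
    Polynomial.C (e.1 i)) P, ?_, fun t _ => ?_⟩
  · have h1 : P.totalDegree ≤ d := by
      refine Finset.sup_le fun m hm => ?_
      have := hP m hm
      rw [Finsupp.degree_eq_sum] at this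
      rw [Finsupp.sum_fintype _ _ (by simp)]
      omega
    refine (MvPolynomial.aeval_natDegree_le (m := d) (n := 1) P h1 _ fun i => ?_).trans_eq
      (mul_one d)
    exact Polynomial.natDegree_linear_le
  · rw [eval_aeval, pev]
    refine congrArg (fun g => MvPolynomial.eval g P) (funext fun i => ?_)
    simp [AffineMap.lineMap_apply]
    ring

lemma IsPolyOnEdge.sub {d : ℕ} {e : Plane × Plane} {g h : Plane → ℝ} (hg : IsPolyOnEdge d e g)
    (hh : IsPolyOnEdge d e h) : IsPolyOnEdge d e (fun x => g x - h x) := by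
  obtain ⟨q, hq, hq'⟩ := hg
  obtain ⟨r, hr, hr'⟩ := hh
  exact ⟨q - r, (Polynomial.natDegree_sub_le_of_le hq hr).trans (by simp),
    fun t ht => by simp [hq' t ht, hr' t ht]⟩

/-! ### Uniqueness and linearity of weak derivatives. -/

section Weak

variable {U : Set Plane}

/-- The fundamental lemma of the calculus of variations, applied to `g - h`. The hypothesis `hi`
only serves to split the integral, so that scalar and vector fields are covered together. -/
lemma ae_eq_of_integral_test_smul_eq {F : Type*} [NormedAddCommGroup F] [NormedSpace ℝ F]
    [CompleteSpace F] (hU : IsOpen U) {g h : Plane → F} (hg : MemLp g 2 (volume.restrict U))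
    (hh : MemLp h 2 (volume.restrict U))
    (hi : ∀ (φ : Plane → ℝ), MemLp φ 2 (volume.restrict U) →
      Integrable (fun x => φ x • g x) (volume.restrict U) ∧
      Integrable (fun x => φ x • h x) (volume.restrict U))
    (H : ∀ φ, IsTest U φ → ∫ x in U, φ x • g x = ∫ x in U, φ x • h x) :
    g =ᵐ[volume.restrict U] h := by
  have hl : LocallyIntegrableOn (fun x => g x - h x) U volume :=
    locallyIntegrableOn_of_locallyIntegrable_restrict
      ((hg.sub hh).locallyIntegrable (by norm_num))
  have := hU.ae_eq_zero_of_integral_contDiff_smul_eq_zero hl fun φ h1 h2 h3 => by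
    have hφ : IsTest U φ := ⟨h1, h2, h3⟩
    rw [← setIntegral_eq_integral_of_forall_compl_eq_zero (s := U) fun x hx => by
      rw [image_eq_zero_of_notMem_tsupport fun h => hx (h3 h), zero_smul]]
    simp_rw [smul_sub]
    rw [integral_sub (hi φ hφ.memLp).1 (hi φ hφ.memLp).2, H φ hφ, sub_self]
  exact (ae_restrict_iff' hU.measurableSet).2 (this.mono fun x hx hxU => sub_eq_zero.1 (hx hxU))

lemma HasWeakGrad.ae_eq (hU : IsOpen U) {v : Plane → ℝ} {G H : Plane → Plane}
    (hG : HasWeakGrad U v G) (hH : HasWeakGrad U v H) : G =ᵐ[volume.restrict U] H :=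
  ae_eq_of_integral_test_smul_eq hU hG.memLp_grad hH.memLp_grad
    (fun _ hφ => ⟨integrable_smul_of_memLp hφ hG.memLp_grad,
      integrable_smul_of_memLp hφ hH.memLp_grad⟩)
    fun φ hφ => neg_injective ((hG.integral_eq φ hφ).symm.trans (hH.integral_eq φ hφ))

lemma HasWeakDiv.ae_eq (hU : IsOpen U) {τ : Plane → Plane} {d d' : Plane → ℝ}
    (hd : HasWeakDiv U τ d) (hd' : HasWeakDiv U τ d') : d =ᵐ[volume.restrict U] d' :=
  ae_eq_of_integral_test_smul_eq hU hd.memLp_div hd'.memLp_div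
    (fun _ hφ => ⟨hφ.integrable_mul hd.memLp_div, hφ.integrable_mul hd'.memLp_div⟩)
    fun φ hφ => by
      simp only [smul_eq_mul, mul_comm (φ _)]
      exact neg_injective ((hd.integral_eq φ hφ).symm.trans (hd'.integral_eq φ hφ))

lemma HasWeakGrad.sub {v w : Plane → ℝ} {G H : Plane → Plane} (hG : HasWeakGrad U v G)
    (hH : HasWeakGrad U w H) : HasWeakGrad U (fun x => v x - w x) (fun x => G x - H x) := by
  refine ⟨hG.memLp.sub hH.memLp, hG.memLp_grad.sub hH.memLp_grad, fun φ hφ => ?_⟩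
  simp_rw [sub_smul, smul_sub]
  rw [integral_sub (integrable_smul_of_memLp hG.memLp hφ.memLp_gradient)
    (integrable_smul_of_memLp hH.memLp hφ.memLp_gradient),
    integral_sub (integrable_smul_of_memLp hφ.memLp hG.memLp_grad)
    (integrable_smul_of_memLp hφ.memLp hH.memLp_grad), hG.integral_eq φ hφ, hH.integral_eq φ hφ]
  abel

lemma HasWeakDiv.sub {σ τ : Plane → Plane} {d d' : Plane → ℝ} (hd : HasWeakDiv U σ d)
    (hd' : HasWeakDiv U τ d') : HasWeakDiv U (fun x => σ x - τ x) (fun x => d x - d' x) := by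
  refine ⟨hd.memLp.sub hd'.memLp, hd.memLp_div.sub hd'.memLp_div, fun φ hφ => ?_⟩
  simp_rw [inner_sub_left, sub_mul]
  rw [integral_sub (integrable_inner_of_memLp hd.memLp hφ.memLp_gradient)
    (integrable_inner_of_memLp hd'.memLp hφ.memLp_gradient), hd.integral_eq φ hφ,
    hd'.integral_eq φ hφ]
  have := integral_sub (hd.memLp_div.integrable_mul hφ.memLp)
    (hd'.memLp_div.integrable_mul hφ.memLp)
  simp only [Pi.mul_apply] at this
  rw [this]
  ring

lemma memLp_coord {τ : Plane → Plane} {μ : Measure Plane} (h : MemLp τ 2 μ) (i : Fin 2) :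
    MemLp (fun x => τ x i) 2 μ :=
  h.continuousLinearMap_comp (EuclideanSpace.proj i : Plane →L[ℝ] ℝ)

lemma HasWeakRot.sub {σ τ : Plane → Plane} {r r' : Plane → ℝ} (hr : HasWeakRot U σ r)
    (hr' : HasWeakRot U τ r') : HasWeakRot U (fun x => σ x - τ x) (fun x => r x - r' x) := by
  refine ⟨hr.memLp.sub hr'.memLp, hr.memLp_rot.sub hr'.memLp_rot, fun φ hφ => ?_⟩
  have hi : ∀ {ρ : Plane → Plane}, MemLp ρ 2 (volume.restrict U) →
      Integrable (fun x => ρ x 0 * gradient φ x 1 - ρ x 1 * gradient φ x 0)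
        (volume.restrict U) := fun h =>
    ((memLp_coord h 0).integrable_mul (memLp_coord hφ.memLp_gradient 1)).sub
      ((memLp_coord h 1).integrable_mul (memLp_coord hφ.memLp_gradient 0))
  have e1 := integral_sub (hi hr.memLp) (hi hr'.memLp)
  have e2 := integral_sub (hr.memLp_rot.integrable_mul hφ.memLp)
    (hr'.memLp_rot.integrable_mul hφ.memLp)
  simp only [Pi.mul_apply] at e2
  rw [hr.integral_eq φ hφ, hr'.integral_eq φ hφ] at e1
  simp_rw [sub_mul, e2]
  rw [neg_sub', ← e1]
  refine integral_congr_ae (.of_forall fun x => ?_)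
  simp only [PiLp.sub_apply]
  ring

lemma MemH1.hasWeakGrad {v : Plane → ℝ} (h : MemH1 U v) : HasWeakGrad U v (weakGrad U v) :=
  Classical.epsilon_spec h

lemma MemHdiv.hasWeakDiv {τ : Plane → Plane} (h : MemHdiv U τ) :
    HasWeakDiv U τ (weakDiv U τ) :=
  Classical.epsilon_spec h

lemma HasWeakGrad.weakGrad_ae_eq (hU : IsOpen U) {v : Plane → ℝ} {G : Plane → Plane}
    (h : HasWeakGrad U v G) : weakGrad U v =ᵐ[volume.restrict U] G :=
  (MemH1.hasWeakGrad ⟨G, h⟩).ae_eq hU h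

lemma HasWeakDiv.weakDiv_ae_eq (hU : IsOpen U) {τ : Plane → Plane} {d : Plane → ℝ}
    (h : HasWeakDiv U τ d) : weakDiv U τ =ᵐ[volume.restrict U] d :=
  (MemHdiv.hasWeakDiv ⟨d, h⟩).ae_eq hU h

end Weak

/-! ### Measure of the boundary of a polygon. -/

lemma integrableOn_of_continuousOn_isCompact {μ : Measure Plane} {s : Set Plane}
    (hs : IsCompact s) (hμ : μ s < ⊤) {g : Plane → ℝ} (hg : ContinuousOn g s) :
    IntegrableOn g s μ := by
  obtain ⟨C, hC⟩ := hs.exists_bound_of_continuousOn hg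
  have : IsFiniteMeasure (μ.restrict s) := ⟨by simpa using hμ⟩
  exact Integrable.of_bound (hg.aestronglyMeasurable_of_isCompact hs hs.measurableSet) C
    ((ae_restrict_iff' hs.measurableSet).2 (.of_forall hC))

lemma hausdorffMeasure_segment_lt_top (x y : Plane) :
    (μH[1] : Measure Plane) (segment ℝ x y) < ⊤ := by
  rw [hausdorffMeasure_segment]
  exact edist_lt_top x y

lemma isCompact_segment (x y : Plane) : IsCompact (segment ℝ x y) := by
  rw [segment_eq_image_lineMap]
  exact isCompact_Icc.image AffineMap.lineMap_continuous

/-- The segment lies on an affine subspace of dimension at most one, a proper subspace of the plane.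
-/
lemma volume_segment (x y : Plane) : volume (segment ℝ x y) = 0 := by
  have h1 : segment ℝ x y ⊆ (line[ℝ, x, y] : Set Plane) :=
    (AffineSubspace.convex _).segment_subset (left_mem_affineSpan_pair ℝ x y)
      (right_mem_affineSpan_pair ℝ x y)
  refine measure_mono_null h1 (Measure.addHaar_affineSubspace _ _ fun h => ?_)
  have h2 : Module.finrank ℝ (vectorSpan ℝ ({x, y} : Set Plane)) = 2 := by
    rw [← direction_affineSpan, h, AffineSubspace.direction_top, finrank_top]
    simp
  have h3 := finrank_vectorSpan_insert_le_set ℝ {y} x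
  rw [vectorSpan_singleton, finrank_bot] at h3
  omega

namespace PolygonalDomain

variable (K : PolygonalDomain)

/-- Otherwise the frontier is empty and the nonempty set is the whole plane, which is unbounded.
This yields the positive boundary length needed to normalize the `H¹` projection. -/
lemma edges_nonempty : K.edges.Nonempty := by
  have h1 : (frontier K.carrier).Nonempty := by
    rw [nonempty_frontier_iff]
    refine ⟨K.isConnected.nonempty, fun h => ?_⟩
    have hb := K.isBounded
    rw [h] at hb
    exact NormedSpace.unbounded_univ ℝ Plane hb
  rw [K.frontier_eq] at h1
  obtain ⟨x, hx⟩ := h1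
  simp only [Set.mem_iUnion] at hx
  obtain ⟨e, he, -⟩ := hx
  exact ⟨e, he⟩

lemma isCompact_closure : IsCompact (closure K.carrier) :=
  K.isBounded.isCompact_closure

lemma isCompact_frontier : IsCompact (frontier K.carrier) :=
  K.isCompact_closure.of_isClosed_subset isClosed_frontier frontier_subset_closure

lemma segment_subset_frontier {e : Plane × Plane} (he : e ∈ K.edges) :
    segment ℝ e.1 e.2 ⊆ frontier K.carrier := by
  rw [K.frontier_eq]
  exact Set.subset_biUnion_of_mem (u := fun e : Plane × Plane => segment ℝ e.1 e.2) he

lemma hausdorffMeasure_frontier_lt_top :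
    (μH[1] : Measure Plane) (frontier K.carrier) < ⊤ := by
  rw [K.frontier_eq]
  exact measure_biUnion_lt_top K.edges.finite_toSet
    fun e _ => hausdorffMeasure_segment_lt_top e.1 e.2

lemma hausdorffMeasure_frontier_pos :
    0 < (μH[1] : Measure Plane) (frontier K.carrier) := by
  obtain ⟨e, he⟩ := K.edges_nonempty
  refine lt_of_lt_of_le ?_ (measure_mono (K.segment_subset_frontier he))
  rw [hausdorffMeasure_segment]
  exact edist_pos.2 (K.ne_of_mem e he)

lemma volume_frontier : volume (frontier K.carrier) = 0 := by
  rw [K.frontier_eq]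
  exact (measure_biUnion_null_iff K.edges.countable_toSet).2 fun e _ => volume_segment e.1 e.2

end PolygonalDomain

/-! ### Normal components on the edges. -/

lemma notMem_endpoints_of_mem_openSegment {e : Plane × Plane} (hne : e.1 ≠ e.2) {x : Plane}
    (hx : x ∈ openSegment ℝ e.1 e.2) : x ∉ ({e.1, e.2} : Set Plane) := by
  rintro (rfl | rfl)
  · exact hne (left_mem_openSegment_iff.1 hx)
  · exact hne (right_mem_openSegment_iff.1 hx)

lemma PolygonalDomain.eq_of_mem_openSegment (K : PolygonalDomain) {e e' : Plane × Plane}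
    (he : e ∈ K.edges) (he' : e' ∈ K.edges) {x : Plane} (hx : x ∈ openSegment ℝ e.1 e.2)
    (hx' : x ∈ openSegment ℝ e'.1 e'.2) : e' = e := by
  by_contra h
  exact notMem_endpoints_of_mem_openSegment (K.ne_of_mem e he) hx
    (K.inter_subset e he e' he' (Ne.symm h)
      ⟨openSegment_subset_segment _ _ _ hx, openSegment_subset_segment _ _ _ hx'⟩).1

/-- The outward normal component of a vector field on the boundary edges (zero off their interiors). -/
noncomputable def edgeNormal (K : PolygonalDomain) (H : Plane → Plane) (x : Plane) : ℝ :=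
  ∑ e ∈ K.edges, (openSegment ℝ e.1 e.2).indicator (fun y => inner ℝ (H y) (outNormal e)) x

lemma edgeNormal_of_mem {K : PolygonalDomain} {e : Plane × Plane} (he : e ∈ K.edges)
    (H : Plane → Plane) {x : Plane} (hx : x ∈ openSegment ℝ e.1 e.2) :
    edgeNormal K H x = inner ℝ (H x) (outNormal e) := by
  rw [edgeNormal, Finset.sum_eq_single_of_mem e he, Set.indicator_of_mem hx]
  exact fun e' he' h => Set.indicator_of_notMem
    (fun hx' => h (K.eq_of_mem_openSegment he he' hx hx')) _

lemma ae_mem_openSegment (x y : Plane) :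
    ∀ᵐ z ∂(μH[1] : Measure Plane).restrict (segment ℝ x y), z ∈ openSegment ℝ x y := by
  have : NullSingletonClass (μH[1] : Measure Plane) :=
    Measure.nullSingletonClass_hausdorff Plane one_pos
  have h : ∀ᵐ z ∂(μH[1] : Measure Plane), z ∉ ({x, y} : Set Plane) :=
    measure_eq_zero_iff_ae_notMem.1 ((Set.toFinite {x, y}).measure_zero _)
  filter_upwards [ae_restrict_mem (isCompact_segment x y).measurableSet, ae_restrict_of_ae h]
    with z hz hz'
  rw [← insert_endpoints_openSegment] at hz
  simp only [Set.mem_insert_iff, Set.mem_singleton_iff, not_or] at hz hz'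
  exact (hz.resolve_left hz'.1).resolve_left hz'.2

/-- The edge parameter extends to the plane as the coordinate of the orthogonal projection onto the
line of the edge. A continuous representative makes edge integrals of `g` finite, although nothing
is known of `g` off the open edge. -/
lemma IsPolyOnEdge.exists_continuous {d : ℕ} {e : Plane × Plane} {g : Plane → ℝ}
    (hne : e.1 ≠ e.2) (hg : IsPolyOnEdge d e g) :
    ∃ h : Plane → ℝ, Continuous h ∧ Set.EqOn g h (openSegment ℝ e.1 e.2) := by
  obtain ⟨q, -, hq⟩ := hg
  refine ⟨fun x => q.eval (inner ℝ (x - e.1) (e.2 - e.1) / inner ℝ (e.2 - e.1) (e.2 - e.1)),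
    q.continuous.comp (by fun_prop), fun x hx => ?_⟩
  rw [openSegment_eq_image_lineMap] at hx
  obtain ⟨t, ht, rfl⟩ := hx
  have h0 : inner ℝ (e.2 - e.1) (e.2 - e.1) ≠ 0 := by
    rw [inner_self_ne_zero]
    exact sub_ne_zero.2 hne.symm
  have : inner ℝ (AffineMap.lineMap e.1 e.2 t - e.1) (e.2 - e.1) /
      inner ℝ (e.2 - e.1) (e.2 - e.1) = t := by
    rw [AffineMap.lineMap_apply, vsub_eq_sub, vadd_eq_add, add_sub_cancel_right,
      real_inner_smul_left, mul_div_assoc, div_self h0, mul_one]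
  rw [hq t ht]
  simp only [this]

lemma IsPolyOnEdge.congr {d : ℕ} {e : Plane × Plane} {g h : Plane → ℝ} (hg : IsPolyOnEdge d e g)
    (H : Set.EqOn g h (openSegment ℝ e.1 e.2)) : IsPolyOnEdge d e h := by
  obtain ⟨q, hq, hq'⟩ := hg
  refine ⟨q, hq, fun t ht => ?_⟩
  rw [← hq' t ht]
  refine (H ?_).symm
  rw [openSegment_eq_image_lineMap]
  exact Set.mem_image_of_mem _ ht

/-- If `Φ m` approximates `τ`, then `Φ m - H` approximates `τ - H`. Polynomiality of `ψ` on the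
edges supplies the integrability needed to split the limit functional. -/
lemma HasNormalTrace.sub_contDiff {K : PolygonalDomain} {p : ℕ} {τ H : Plane → Plane}
    {ψ : Plane → ℝ} (h : HasNormalTrace K τ ψ) (hψ : ∀ e ∈ K.edges, IsPolyOnEdge p e ψ)
    (hH : ContDiff ℝ ∞ H) :
    HasNormalTrace K (fun x => τ x - H x) (fun x => ψ x - edgeNormal K H x) := by
  obtain ⟨hτ, Φ, hΦ, h1, h2, h3⟩ := h
  have hd := hτ.hasWeakDiv.sub (hasWeakDiv_divergence K.isOpen K.isBounded hH)
  refine ⟨⟨_, hd⟩, fun m x => Φ m x - H x, fun m => (hΦ m).sub hH, ?_, ?_, fun φ hφ => ?_⟩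
  · simpa only [sub_sub_sub_cancel_right] using h1
  · refine h2.congr fun m => eLpNorm_congr_ae ?_
    filter_upwards [hd.weakDiv_ae_eq K.isOpen] with x hx
    have hs : divergence (fun x => Φ m x - H x) x = divergence (Φ m) x - divergence H x := by
      simp only [divergence, ← Finset.sum_sub_distrib]
      refine Finset.sum_congr rfl fun i _ => ?_
      rw [fderiv_fun_sub ((hΦ m).differentiable (by simp) x) (hH.differentiable (by simp) x)]
      rfl
    rw [hx, hs]
    ring
  · have hc : ∀ {g : Plane → ℝ}, Continuous g → ∀ e : Plane × Plane,
        IntegrableOn g (segment ℝ e.1 e.2) (μH[1] : Measure Plane) := fun hg e =>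
      integrableOn_of_continuousOn_isCompact (isCompact_segment _ _)
        (hausdorffMeasure_segment_lt_top _ _) hg.continuousOn
    have hn : ∀ {G : Plane → Plane}, ContDiff ℝ ∞ G → ∀ e : Plane × Plane,
        IntegrableOn (fun x => inner ℝ (G x) (outNormal e) * φ x) (segment ℝ e.1 e.2)
          (μH[1] : Measure Plane) := fun hG e =>
      hc ((hG.continuous.inner continuous_const).mul hφ.continuous) e
    convert (h3 φ hφ).sub_const (∑ e ∈ K.edges, ∫ x in segment ℝ e.1 e.2,
      inner ℝ (H x) (outNormal e) * φ x ∂(μH[1] : Measure Plane)) using 2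
    · rw [← Finset.sum_sub_distrib]
      refine Finset.sum_congr rfl fun e _ => ?_
      rw [← integral_sub (hn (hΦ _) e) (hn hH e)]
      simp only [inner_sub_left, sub_mul]
    · rw [← Finset.sum_sub_distrib]
      refine Finset.sum_congr rfl fun e he => ?_
      have hi : IntegrableOn (fun x => ψ x * φ x) (segment ℝ e.1 e.2)
          (μH[1] : Measure Plane) := by
        obtain ⟨g, hg, hg'⟩ := (hψ e he).exists_continuous (K.ne_of_mem e he)
        refine (hc (hg.mul hφ.continuous) e).congr ?_
        filter_upwards [ae_mem_openSegment e.1 e.2] with x hx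
        simp [hg' hx]
      rw [← integral_sub hi (hn hH e)]
      refine integral_congr_ae ?_
      filter_upwards [ae_mem_openSegment e.1 e.2] with x hx
      rw [edgeNormal_of_mem he H hx, sub_mul]

/-! ### Projections onto gradients of polynomials -/

lemma memLp_pgrad {U : Set Plane} (hU : IsOpen U) (hb : Bornology.IsBounded U)
    (P : MvPolynomial (Fin 2) ℝ) : MemLp (pgrad P) 2 (volume.restrict U) :=
  memLp_of_continuousOn_closure hU hb (contDiff_pgrad P).continuous.continuousOn

/-- The gradients of polynomials of degree `< d` form a finite-dimensional subspace of `L²(U)`, so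
the orthogonal projection onto it exists. -/
lemma exists_pgrad_projection {U : Set Plane} (hU : IsOpen U)
    (hb : Bornology.IsBounded U) {F : Plane → Plane} (hF : MemLp F 2 (volume.restrict U)) (d : ℕ) :
    ∃ P, DegLT d P ∧ ∀ Q, DegLT d Q →
      ∫ x in U, inner ℝ (F x - pgrad P x) (pgrad Q x) = 0 := by
  let L : degLTSubmodule d →ₗ[ℝ] Lp Plane 2 (volume.restrict U) :=
    { toFun := fun P => (memLp_pgrad hU hb P.1).toLp
      map_add' := fun P Q => by
        rw [← MemLp.toLp_add]
        congr 1
        ext1 x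
        exact pgrad_add P.1 Q.1 x
      map_smul' := fun c P => by
        rw [RingHom.id_apply, ← MemLp.toLp_const_smul]
        congr 1
        ext1 x
        exact pgrad_smul c P.1 x }
  let W := LinearMap.range L
  obtain ⟨P, hP⟩ : W.starProjection (hF.toLp F) ∈ W := W.starProjection_apply_mem _
  refine ⟨P.1, P.2, fun Q hQ => ?_⟩
  have h := W.starProjection_inner_eq_zero (hF.toLp F) (L ⟨Q, hQ⟩) ⟨_, rfl⟩
  rw [← hP, L2.inner_def] at h
  rw [← h]
  refine integral_congr_ae ?_
  filter_upwards [hF.coeFn_toLp, (memLp_pgrad hU hb P.1).coeFn_toLp,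
    (memLp_pgrad hU hb Q).coeFn_toLp, Lp.coeFn_sub (hF.toLp F) (L P)] with x h1 h2 h3 h4
  rw [h4, Pi.sub_apply, h1]
  change _ = inner ℝ (F x - (memLp_pgrad hU hb P.1).toLp _ x) ((memLp_pgrad hU hb Q).toLp _ x)
  rw [h2, h3]

/-! ### The local projectors and their kernels. -/

section Projectors

variable {K : PolygonalDomain} {κ : Plane → ℝ} {c : ℝ} {p : ℕ}

lemma MemLocalPrimal.memH1 {v : Plane → ℝ} (h : MemLocalPrimal K p v) : MemH1 K.carrier v := by
  obtain ⟨G, -, hG, -⟩ := h.laplace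
  exact ⟨G, hG⟩

lemma setIntegral_mul_eq_of_eqOn {U : Set Plane} (hU : IsOpen U) {w : Plane → ℝ}
    (hw : ∀ x ∈ U, w x = c) (g : Plane → ℝ) :
    ∫ x in U, w x * g x = c * ∫ x in U, g x := by
  rw [← integral_const_mul]
  exact setIntegral_congr_fun hU.measurableSet fun x hx => by simp [hw x hx]

/-- As `κ` is constant on the element, the weighted projection of the gradient is the unweighted
one. It leaves an additive constant free, which the boundary condition fixes. -/
lemma MemLocalPrimal.isPiNabla_piNabla (hκ : ∀ x ∈ K.carrier, κ x = c) {v : Plane → ℝ}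
    (h : MemLocalPrimal K p v) : IsPiNabla K κ p v (piNabla K κ p v) := by
  refine Classical.epsilon_spec (p := IsPiNabla K κ p v) ?_
  obtain ⟨P, hP, hPQ⟩ := exists_pgrad_projection K.isOpen K.isBounded
    h.memH1.hasWeakGrad.memLp_grad (p + 1)
  have hfin := K.hausdorffMeasure_frontier_lt_top
  set m : ℝ := (μH[1] : Measure Plane).real (frontier K.carrier)
  set b : ℝ := ∫ x in frontier K.carrier, (v x - pev P x) ∂(μH[1] : Measure Plane)
  have hm : m ≠ 0 := (ENNReal.toReal_pos K.hausdorffMeasure_frontier_pos.ne' hfin.ne).ne'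
  -- The constant `b / m` is the mean of `v - P` over the boundary.
  refine ⟨P + MvPolynomial.C (b / m), hP.add (degLT_C p.succ_pos _), fun Q hQ => ?_, ?_⟩
  · rw [setIntegral_mul_eq_of_eqOn K.isOpen hκ]
    simp only [pgrad_add, pgrad_C, add_zero, hPQ Q hQ, mul_zero]
  · have hi : IntegrableOn (fun x => v x - pev P x) (frontier K.carrier)
        (μH[1] : Measure Plane) :=
      integrableOn_of_continuousOn_isCompact K.isCompact_frontier hfin
        ((h.continuousOn.mono frontier_subset_closure).sub
          (contDiff_pev P).continuous.continuousOn)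
    have hci : IntegrableOn (fun _ => b / m) (frontier K.carrier) (μH[1] : Measure Plane) :=
      integrableOn_of_continuousOn_isCompact K.isCompact_frontier hfin continuousOn_const
    simp only [pev_add, pev_C, ← sub_sub]
    rw [integral_sub hi hci, setIntegral_const, smul_eq_mul, mul_div_cancel₀ _ hm, sub_self]

/-- Polynomials in `ℙ_p(K)` belong to the local space: they have degree at most `p` on edges, and
their Laplacian lies in `ℙ_{p-2}(K)`. -/
lemma MemLocalPrimal.sub_pev {v : Plane → ℝ} (h : MemLocalPrimal K p v)
    {P : MvPolynomial (Fin 2) ℝ} (hP : DegLT (p + 1) P) :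
    MemLocalPrimal K p (fun x => v x - pev P x) := by
  obtain ⟨G, Q, hG, hQ, hd⟩ := h.laplace
  refine ⟨h.continuousOn.sub (contDiff_pev P).continuous.continuousOn,
    fun e he => (h.poly_edge e he).sub (hP.isPolyOnEdge e), ?_⟩
  have h1 := hasWeakGrad_gradient K.isOpen K.isBounded (contDiff_pev P)
  have h2 := hasWeakDiv_divergence K.isOpen K.isBounded (contDiff_pgrad P)
  rw [gradient_pev] at h1
  rw [divergence_pgrad] at h2
  refine ⟨_, Q - plaplace P, hG.sub h1, hQ.sub hP.plaplace, ?_⟩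
  convert hd.sub h2 using 1
  ext x
  simp [pev]

lemma weakGrad_sub_pev_ae_eq {v : Plane → ℝ} (h : MemH1 K.carrier v)
    (P : MvPolynomial (Fin 2) ℝ) :
    weakGrad K.carrier (fun x => v x - pev P x) =ᵐ[volume.restrict K.carrier]
      fun x => weakGrad K.carrier v x - pgrad P x := by
  have h1 := hasWeakGrad_gradient K.isOpen K.isBounded (contDiff_pev P)
  rw [gradient_pev] at h1
  exact (h.hasWeakGrad.sub h1).weakGrad_ae_eq K.isOpen

/-- Makes the stabilization bounds, which are assumed on the kernel only, available for `(I - Π^∇_p)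
v`. -/
lemma MemLocalPrimal.memKerPiNabla_subPiNabla (hκ : ∀ x ∈ K.carrier, κ x = c)
    {v : Plane → ℝ} (h : MemLocalPrimal K p v) : MemKerPiNabla K κ p (subPiNabla K κ p v) := by
  have hP := h.isPiNabla_piNabla hκ
  refine ⟨h.sub_pev hP.degLT, degLT_zero _, fun Q hQ => ?_, ?_⟩
  · rw [← hP.orthogonal Q hQ]
    refine integral_congr_ae ?_
    filter_upwards [weakGrad_sub_pev_ae_eq h.memH1 (piNabla K κ p v)] with x hx
    rw [pgrad_zero, sub_zero]
    exact congrArg (fun y => κ x * inner ℝ y (pgrad Q x)) hx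
  · rw [← hP.boundary]
    simp [subPiNabla, pev]

lemma exists_isPiFlux (hκ : ∀ x ∈ K.carrier, κ x = c) {τ : Plane → Plane}
    (h : MemLp τ 2 (volume.restrict K.carrier)) : ∃ R, IsPiFlux K κ p τ R := by
  obtain ⟨P, hP, hPQ⟩ := exists_pgrad_projection K.isOpen K.isBounded h (p + 2)
  refine ⟨P, hP, fun Q hQ => ?_⟩
  rw [setIntegral_mul_eq_of_eqOn (w := fun x => (κ x)⁻¹) (c := c⁻¹) K.isOpen
    (fun x hx => by rw [hκ x hx]), hPQ Q hQ, mul_zero]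

lemma exists_piFlux_eq (hκ : ∀ x ∈ K.carrier, κ x = c) {τ : Plane → Plane}
    (h : MemLp τ 2 (volume.restrict K.carrier)) :
    ∃ R, piFlux K κ p τ = pgrad R ∧ IsPiFlux K κ p τ R :=
  ⟨_, rfl, Classical.epsilon_spec (exists_isPiFlux hκ h)⟩

lemma MemLocalFlux.memLp {τ : Plane → Plane} {ψ : Plane → ℝ} (h : MemLocalFlux K p τ ψ) :
    MemLp τ 2 (volume.restrict K.carrier) :=
  h.hasNormalTrace.1.hasWeakDiv.memLp

/-- The fields in `∇ℙ_{p+1}(K)` belong to the local flux space: the normal is constant on each edge,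
so the normal component has degree at most `p`; the divergence is a Laplacian, of degree at most `p
- 1`; the rotor vanishes. -/
lemma MemLocalFlux.sub_pgrad {τ : Plane → Plane} {ψ : Plane → ℝ} (h : MemLocalFlux K p τ ψ)
    {R : MvPolynomial (Fin 2) ℝ} (hR : DegLT (p + 2) R) :
    MemLocalFlux K p (fun x => τ x - pgrad R x) (fun x => ψ x - edgeNormal K (pgrad R) x) := by
  refine ⟨h.hasNormalTrace.sub_contDiff h.poly_edge (contDiff_pgrad R), fun e he => ?_, ?_, ?_⟩
  · have hc : DegLT (p + 1) (∑ i : Fin 2, outNormal e i • MvPolynomial.pderiv i R) :=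
      (degLTSubmodule (p + 1)).sum_mem (t := Finset.univ) fun i _ =>
        (degLTSubmodule (p + 1)).smul_mem _ (hR.pderiv i)
    refine ((h.poly_edge e he).sub (hc.isPolyOnEdge e)).congr fun x hx => ?_
    simp only [edgeNormal_of_mem he _ hx, PiLp.inner_apply, pgrad_apply]
    simp [pev, MvPolynomial.smul_eval]
  · obtain ⟨Q, hQ, hd⟩ := h.div_poly
    refine ⟨Q - plaplace R, hQ.sub hR.plaplace, ?_⟩
    have h2 := hasWeakDiv_divergence K.isOpen K.isBounded (contDiff_pgrad R)
    rw [divergence_pgrad] at h2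
    convert hd.sub h2 using 1
    ext x
    simp [pev]
  · obtain ⟨Q, hQ, hr⟩ := h.rot_poly
    refine ⟨Q, hQ, ?_⟩
    have h2 := hasWeakRot_gradient K.isOpen K.isBounded (contDiff_pev R)
    rw [gradient_pev] at h2
    simpa using hr.sub h2

lemma MemLocalFlux.memKerPiFlux_subPiFlux (hκ : ∀ x ∈ K.carrier, κ x = c)
    {τ : Plane → Plane} {ψ : Plane → ℝ} (h : MemLocalFlux K p τ ψ) :
    MemKerPiFlux K κ p (subPiFlux K κ p τ) := by
  obtain ⟨R, hR, hPi⟩ := exists_piFlux_eq (p := p) hκ h.memLp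
  refine ⟨⟨fun x => ψ x - edgeNormal K (piFlux K κ p τ) x, ?_⟩, degLT_zero _, fun Q hQ => ?_⟩
  · have := h.sub_pgrad hPi.degLT
    rw [← hR] at this
    exact this
  · rw [← hPi.orthogonal Q hQ]
    simp only [subPiFlux, hR, pgrad_zero, sub_zero]

end Projectors

/-! ### Equivalence of the primal and the mixed weak formulation -/

/-- The constant sequence `φ` shows the trace to be zero, because the support of `φ` lies in the
open set and misses its frontier. -/
lemma IsTest.memPrimalSpace {Ω : PolygonalDomain} {φ : Plane → ℝ} (hφ : IsTest Ω.carrier φ)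
    (ΓD : Set Plane) : MemPrimalSpace Ω ΓD (fun _ => 0) φ (fun _ => 0) := by
  have hG := hasWeakGrad_gradient Ω.isOpen Ω.isBounded hφ.1
  refine ⟨⟨_, hG⟩, ⟨MemLp.zero', fun _ => φ, fun _ => hφ.1, ?_, ?_, ?_⟩, ae_eq_refl _⟩
  · simp
  · refine tendsto_const_nhds.congr fun m => ?_
    rw [← eLpNorm_zero (ε := Plane) (p := 2) (μ := volume.restrict Ω.carrier)]
    refine eLpNorm_congr_ae ?_
    filter_upwards [hG.weakGrad_ae_eq Ω.isOpen] with x hx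
    simp [hx]
  · refine tendsto_const_nhds.congr fun m => ?_
    rw [← eLpNorm_zero (ε := ℝ) (p := 2) (μ := (μH[1] : Measure Plane).restrict
      (frontier Ω.carrier))]
    refine eLpNorm_congr_ae ?_
    filter_upwards [ae_restrict_mem isClosed_frontier.measurableSet] with x hx
    rw [Ω.isOpen.frontier_eq] at hx
    simp [image_eq_zero_of_notMem_tsupport fun h => hx.2 (hφ.2.2 h)]

/-- The open elements cover `Ω` up to their frontiers, finitely many null sets, and `κ` is constant
on each of them. -/
lemma Mesh.PiecewiseConstant.aestronglyMeasurable {Ω : PolygonalDomain} {T : Mesh Ω}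
    {κ : Plane → ℝ} (hK : T.PiecewiseConstant κ) :
    AEStronglyMeasurable κ (volume.restrict Ω.carrier) := by
  have h1 : AEStronglyMeasurable κ (volume.restrict (⋃ i, (T.elem i).carrier)) := by
    refine AEStronglyMeasurable.iUnion fun i => ?_
    obtain ⟨c, hc⟩ := hK i
    refine (aestronglyMeasurable_const (b := c)).congr ?_
    filter_upwards [ae_restrict_mem (T.elem i).isOpen.measurableSet] with x hx
    exact (hc x hx).symm
  refine h1.mono_measure (Measure.restrict_mono_ae ?_)
  have h2 : ∀ᵐ x ∂(volume : Measure Plane), ∀ i, x ∉ frontier (T.elem i).carrier :=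
    ae_all_iff.2 fun i => measure_eq_zero_iff_ae_notMem.1 (T.elem i).volume_frontier
  filter_upwards [h2] with x hx (hxΩ : x ∈ Ω.carrier)
  have h3 : x ∈ ⋃ i, closure (T.elem i).carrier := by
    rw [T.iUnion_closure]
    exact subset_closure hxΩ
  obtain ⟨i, hi⟩ := Set.mem_iUnion.1 h3
  refine Set.mem_iUnion.2 ⟨i, ?_⟩
  by_contra h
  exact hx i ((T.elem i).isOpen.frontier_eq ▸ ⟨hi, h⟩)

lemma memLp_smul_of_ae_bound {μ : Measure Plane} {w : Plane → ℝ} {C : ℝ}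
    (hw : AEStronglyMeasurable w μ) (hC : ∀ᵐ x ∂μ, |w x| ≤ C) {G : Plane → Plane}
    (hG : MemLp G 2 μ) : MemLp (fun x => w x • G x) 2 μ := by
  refine hG.of_le_mul (c := C) (hw.smul hG.1) ?_
  filter_upwards [hC] with x hx
  rw [norm_smul, Real.norm_eq_abs]
  exact mul_le_mul_of_nonneg_right hx (norm_nonneg _)

lemma IsPrimalSolution.memH1 {Ω : PolygonalDomain} {ΓD ΓN : Set Plane}
    {κ f gD gN u : Plane → ℝ} (h : IsPrimalSolution Ω ΓD ΓN κ f gD gN u) :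
    MemH1 Ω.carrier u := by
  obtain ⟨γ, hγ⟩ := h.mem
  exact hγ.memH1

section Continuous

variable {Ω : PolygonalDomain} {ΓD ΓN : Set Plane} {κ f gD gN ut u : Plane → ℝ}
  {σ : Plane → Plane}

/-- Test functions have zero trace, so the Neumann term drops out of the primal equation. -/
lemma IsPrimalSolution.hasWeakDiv (h : IsPrimalSolution Ω ΓD ΓN κ f gD gN ut)
    (hf : MemLp f 2 (volume.restrict Ω.carrier))
    (hκG : MemLp (fun x => κ x • weakGrad Ω.carrier ut x) 2 (volume.restrict Ω.carrier)) :
    HasWeakDiv Ω.carrier (fun x => -(κ x • weakGrad Ω.carrier ut x)) f := by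
  refine ⟨hκG.neg, hf, fun φ hφ => ?_⟩
  have h1 := h.eq φ _ (hφ.memPrimalSpace ΓD)
  simp only [mul_zero, integral_zero, add_zero] at h1
  simp only [inner_neg_left, integral_neg, neg_inj, real_inner_smul_left]
  rw [← h1]
  refine integral_congr_ae ?_
  filter_upwards [(hasWeakGrad_gradient Ω.isOpen Ω.isBounded hφ.1).weakGrad_ae_eq Ω.isOpen]
    with x hx
  rw [hx]

lemma IsMixedSolution.weakDiv_ae_eq (h : IsMixedSolution Ω ΓD ΓN κ f gD gN σ u)
    (hf : MemLp f 2 (volume.restrict Ω.carrier)) :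
    weakDiv Ω.carrier σ =ᵐ[volume.restrict Ω.carrier] f := by
  have hd := h.mem.memHdiv.hasWeakDiv.memLp_div
  refine ae_eq_of_integral_test_smul_eq Ω.isOpen hd hf
    (fun _ hφ => ⟨hφ.integrable_mul hd, hφ.integrable_mul hf⟩) fun φ hφ => ?_
  have h1 := h.eq_div φ hφ.memLp
  simp only [neg_mul, integral_neg, neg_inj] at h1
  simpa only [smul_eq_mul, mul_comm (φ _)] using h1

/-- The flux of the mixed formulation is `-κ ∇u` for the solution `u` of the primal formulation. -/
lemma IsMixedSolution.ae_eq_neg_smul_weakGrad (hσ : IsMixedSolution Ω ΓD ΓN κ f gD gN σ u)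
    (hut : IsPrimalSolution Ω ΓD ΓN κ f gD gN ut)
    (hf : MemLp f 2 (volume.restrict Ω.carrier)) {kmin kmax : ℝ} (hkmin : 0 < kmin)
    (hκ : ∀ᵐ x ∂(volume.restrict Ω.carrier), kmin ≤ κ x ∧ κ x ≤ kmax)
    (hm : AEStronglyMeasurable κ (volume.restrict Ω.carrier)) :
    σ =ᵐ[volume.restrict Ω.carrier] fun x => -(κ x • weakGrad Ω.carrier ut x) := by
  set G := weakGrad Ω.carrier ut with hGdef
  have hG : MemLp G 2 (volume.restrict Ω.carrier) := hut.memH1.hasWeakGrad.memLp_grad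
  have hσ2 : MemLp σ 2 (volume.restrict Ω.carrier) := hσ.mem.memHdiv.hasWeakDiv.memLp
  have hκG : MemLp (fun x => κ x • G x) 2 (volume.restrict Ω.carrier) :=
    memLp_smul_of_ae_bound hm (hκ.mono fun x hx => by
      rw [abs_of_pos (hkmin.trans_le hx.1)]; exact hx.2) hG
  have hκσ : MemLp (fun x => (κ x)⁻¹ • σ x) 2 (volume.restrict Ω.carrier) :=
    memLp_smul_of_ae_bound (C := kmin⁻¹) hm.aemeasurable.inv.aestronglyMeasurable
      (hκ.mono fun x hx => by
        rw [Pi.inv_apply, abs_of_pos (inv_pos.2 (hkmin.trans_le hx.1))]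
        exact inv_anti₀ hkmin hx.1) hσ2
  set τ : Plane → Plane := fun x => σ x - -(κ x • G x) with hτdef
  have hdiv := hσ.weakDiv_ae_eq hf
  have hτdiv : HasWeakDiv Ω.carrier τ (fun x => weakDiv Ω.carrier σ x - f x) :=
    hσ.mem.memHdiv.hasWeakDiv.sub (hut.hasWeakDiv hf hκG)
  have hτ2 := hτdiv.memLp
  have hτ0 : ∀ᵐ x ∂(volume.restrict Ω.carrier), weakDiv Ω.carrier τ x = 0 := by
    filter_upwards [hτdiv.weakDiv_ae_eq Ω.isOpen, hdiv] with x h1 h2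
    rw [h1, h2, sub_self]
  have hpair : ∀ v, normalPairing Ω τ v =
      ∫ x in Ω.carrier, inner ℝ (τ x) (weakGrad Ω.carrier v x) := fun v => by
    refine integral_congr_ae ?_
    filter_upwards [hτ0] with x hx
    rw [hx, zero_mul, add_zero]
  -- The Neumann terms of `σ` and of `κ ∇ũ` cancel, and so do the two load terms.
  have hflux : MemFluxSpace Ω ΓD ΓN (fun _ => 0) τ := by
    refine ⟨⟨_, hτdiv⟩, fun v γ hv => ?_⟩
    have hvG := hv.memH1.hasWeakGrad
    have i1 := integrable_inner_of_memLp hσ2 hvG.memLp_grad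
    have i2 := integrable_inner_of_memLp hκG hvG.memLp_grad
    have i3 : Integrable (fun x => f x * v x) (volume.restrict Ω.carrier) :=
      hf.integrable_mul hvG.memLp
    have e1 := hσ.mem.normal_eq v γ hv
    have e2 := hut.eq v γ hv
    have e3 : normalPairing Ω σ v = (∫ x in Ω.carrier, inner ℝ (σ x) (weakGrad Ω.carrier v x))
        + ∫ x in Ω.carrier, f x * v x := by
      rw [← integral_add i1 i3]
      refine integral_congr_ae ?_
      filter_upwards [hdiv] with x hx
      rw [hx]
    rw [hpair]
    simp only [hτdef, sub_neg_eq_add, inner_add_left]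
    rw [integral_add i1 i2]
    simp only [real_inner_smul_left, neg_mul, integral_neg] at e1 ⊢
    rw [e2]
    simp only [zero_mul, integral_zero]
    linarith
  obtain ⟨γ, hγ⟩ := hut.mem
  -- The primal solution serves as the lifting of `g_D`.
  have key := hσ.eq_flux τ hflux ut γ hγ
  have e4 : ∫ x in Ω.carrier, weakDiv Ω.carrier τ x * u x = 0 := by
    rw [← integral_zero Plane ℝ (μ := volume.restrict Ω.carrier)]
    refine integral_congr_ae ?_
    filter_upwards [hτ0] with x hx
    rw [hx, zero_mul]
  rw [hpair, e4, neg_zero, add_zero] at key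
  have j1 := integrable_inner_of_memLp hκσ hτ2
  have j2 := integrable_inner_of_memLp hτ2 hG
  -- This is `κ⁻¹ τ = κ⁻¹ σ + ∇ũ` paired with `τ`.
  have e5 : (fun x => inner ℝ ((κ x)⁻¹ • σ x) (τ x) + inner ℝ (τ x) (G x))
      =ᵐ[volume.restrict Ω.carrier] fun x => (κ x)⁻¹ * ‖τ x‖ ^ 2 := by
    filter_upwards [hκ] with x hx
    have hne : κ x ≠ 0 := (hkmin.trans_le hx.1).ne'
    rw [real_inner_comm, ← inner_add_right, ← real_inner_self_eq_norm_sq,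
      ← real_inner_smul_right]
    congr 1
    simp only [hτdef, sub_neg_eq_add, smul_add, smul_smul, inv_mul_cancel₀ hne, one_smul]
  have e6 : ∫ x in Ω.carrier, (κ x)⁻¹ * ‖τ x‖ ^ 2 = 0 := by
    rw [← integral_congr_ae e5, integral_add j1 j2]
    simp only [real_inner_smul_left]
    rw [key]
    exact neg_add_cancel _
  rw [integral_eq_zero_iff_of_nonneg_ae] at e6
  · filter_upwards [e6, hκ] with x hx hx'
    have hpos : 0 < (κ x)⁻¹ := inv_pos.2 (hkmin.trans_le hx'.1)
    have h0 : ‖τ x‖ ^ 2 = 0 := (mul_eq_zero.1 hx).resolve_left hpos.ne'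
    exact sub_eq_zero.1 (norm_eq_zero.1 (pow_eq_zero_iff two_ne_zero |>.1 h0))
  · filter_upwards [hκ] with x hx
    exact mul_nonneg (inv_pos.2 (hkmin.trans_le hx.1)).le (sq_nonneg _)
  · exact (j1.add j2).congr e5

end Continuous

/-! ### Local estimates -/

section Local

variable {U : Set Plane}

lemma integrable_norm_sq {μ : Measure Plane} {F : Plane → Plane} (hF : MemLp F 2 μ) :
    Integrable (fun x => ‖F x‖ ^ 2) μ := by
  simpa only [real_inner_self_eq_norm_sq] using integrable_inner_of_memLp hF hF

lemma normSq_nonneg (U : Set Plane) (F : Plane → Plane) : 0 ≤ normSq U F :=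
  integral_nonneg fun _ => sq_nonneg _

/-- With `a = x - P`, `b = y - P`, `c = q - P`, one has `|a-b|² + |a-c|² + 2 b·c - |a|² = |a-b-c|²`,
and `∫ b·c = 0`. For the second bound, orthogonality gives `‖b‖² ≤ ‖b - c‖²`, and `b - c` is the
difference of `a - c` and `a - b`. -/
lemma normSq_sub_le_of_orthogonal {x y P q : Plane → Plane}
    (hx : MemLp x 2 (volume.restrict U)) (hy : MemLp y 2 (volume.restrict U))
    (hP : MemLp P 2 (volume.restrict U)) (hq : MemLp q 2 (volume.restrict U))
    (h : ∫ z in U, inner ℝ (y z - P z) (q z - P z) = 0) :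
    normSq U (fun z => x z - P z) ≤
        normSq U (fun z => x z - y z) + normSq U (fun z => x z - q z) ∧
      normSq U (fun z => y z - P z) ≤
        2 * (normSq U (fun z => x z - y z) + normSq U (fun z => x z - q z)) := by
  have i1 := integrable_norm_sq (hx.sub hy)
  have i2 := integrable_norm_sq (hx.sub hq)
  have i3 := integrable_inner_of_memLp (hy.sub hP) (hq.sub hP)
  simp only [Pi.sub_apply] at i1 i2 i3
  have i4 : Integrable (fun z => ‖x z - y z‖ ^ 2 + ‖x z - q z‖ ^ 2) (volume.restrict U) :=
    i1.add i2
  -- Adding the integrand `2 b·c`, of zero integral, reduces both bounds to pointwise inequalities.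
  have e : ∀ c : ℝ, c * (normSq U (fun z => x z - y z) + normSq U (fun z => x z - q z)) =
      ∫ z in U, (c * (‖x z - y z‖ ^ 2 + ‖x z - q z‖ ^ 2) +
        2 * inner ℝ (y z - P z) (q z - P z)) := fun c => by
    rw [integral_add (i4.const_mul c) (i3.const_mul 2), integral_const_mul,
      integral_add i1 i2, integral_const_mul, h, mul_zero, add_zero]
    rfl
  have hi : ∀ c : ℝ, Integrable (fun z => c * (‖x z - y z‖ ^ 2 + ‖x z - q z‖ ^ 2) +
      2 * inner ℝ (y z - P z) (q z - P z)) (volume.restrict U) := fun c =>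
    (i4.const_mul c).add (i3.const_mul 2)
  refine ⟨?_, ?_⟩
  · rw [← one_mul (normSq U (fun z => x z - y z) + normSq U (fun z => x z - q z)), e]
    refine integral_mono (integrable_norm_sq (hx.sub hP)) (hi 1) fun z => ?_
    have h1 := sq_nonneg ‖(x z - P z) - ((y z - P z) + (q z - P z))‖
    rw [norm_sub_sq_real, norm_add_sq_real, inner_add_right] at h1
    have h2 := norm_sub_sq_real (x z - P z) (y z - P z)
    have h3 := norm_sub_sq_real (x z - P z) (q z - P z)
    rw [sub_sub_sub_cancel_right] at h2 h3
    simp only [h2, h3]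
    linarith
  · rw [e]
    refine integral_mono (integrable_norm_sq (hy.sub hP)) (hi 2) fun z => ?_
    have h1 := sq_nonneg ‖(x z - y z) + (x z - q z)‖
    have h2 := norm_sub_sq_real (y z - P z) (q z - P z)
    have h3 := norm_add_sq_real (x z - y z) (x z - q z)
    have h4 := norm_sub_sq_real (x z - q z) (x z - y z)
    rw [sub_sub_sub_cancel_right] at h2
    rw [sub_sub_sub_cancel_left, real_inner_comm] at h4
    have h5 := sq_nonneg ‖q z - P z‖
    simp only
    linarith

lemma normSq_add_le {F H : Plane → Plane} (hF : MemLp F 2 (volume.restrict U))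
    (hH : MemLp H 2 (volume.restrict U)) :
    normSq U (fun x => F x + H x) ≤ 2 * (normSq U F + normSq U H) := by
  rw [normSq, normSq, normSq, ← integral_add (integrable_norm_sq hF) (integrable_norm_sq hH),
    ← integral_const_mul]
  refine integral_mono (integrable_norm_sq (hF.add hH))
    (((integrable_norm_sq hF).add (integrable_norm_sq hH)).const_mul 2) fun x => ?_
  have h1 := norm_add_sq_real (F x) (H x)
  have h2 := norm_sub_sq_real (F x) (H x)
  have h3 := sq_nonneg ‖F x - H x‖
  simp only
  linarith

lemma normSq_congr {F H : Plane → Plane} (h : F =ᵐ[volume.restrict U] H) :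
    normSq U F = normSq U H := by
  refine integral_congr_ae ?_
  filter_upwards [h] with x hx
  rw [hx]

lemma normSq_smul_of_eqOn (hU : IsOpen U) {w : Plane → ℝ} {c : ℝ} (hw : ∀ x ∈ U, w x = c)
    (F : Plane → Plane) : normSq U (fun x => w x • F x) = c ^ 2 * normSq U F := by
  rw [normSq, normSq, ← integral_const_mul]
  refine setIntegral_congr_fun hU.measurableSet fun x hx => ?_
  simp only [hw x hx, norm_smul, mul_pow, Real.norm_eq_abs, sq_abs]

/-- The exact fields cancel, `√k x + (√k)⁻¹ s = 0`, so the discrete residual is minus the sum of the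
weighted errors. -/
lemma sqrt_smul_add_inv_sqrt_smul {k : ℝ} (x P s R : Plane) (hs : s = -(k • x)) :
    √k • P + (√k)⁻¹ • R = -((√k • (x - P)) + (√k)⁻¹ • (s - R)) := by
  have h : (√k)⁻¹ * k = √k := by
    rw [inv_mul_eq_div, Real.div_sqrt]
  rw [hs, smul_sub, smul_sub, smul_neg, smul_smul, h]
  abel

/-- A nonempty open set has positive measure, so the almost everywhere bound holds at some point of
it. -/
lemma PolygonalDomain.pos_of_ae_le {K : PolygonalDomain} {κ : Plane → ℝ} {c k : ℝ}
    (hκ : ∀ x ∈ K.carrier, κ x = c) (hk : 0 < k)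
    (h : ∀ᵐ x ∂(volume.restrict K.carrier), k ≤ κ x) : 0 < c := by
  have hne : volume K.carrier ≠ 0 := (K.isOpen.measure_pos volume K.isConnected.nonempty).ne'
  have : (ae (volume.restrict K.carrier)).NeBot := by
    rw [ae_neBot, Ne, Measure.restrict_eq_zero]
    exact hne
  obtain ⟨x, hx, hxK⟩ := (h.and (ae_restrict_mem K.isOpen.measurableSet)).exists
  rw [← hκ x hxK]
  exact hk.trans_le hx

variable {K : PolygonalDomain} {κ : Plane → ℝ} {c : ℝ} {p : ℕ}

lemma IsPrimalStab.subPiNabla_le {αlo αhi : ℝ} {S : (Plane → ℝ) → (Plane → ℝ) → ℝ}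
    (hS : IsPrimalStab K κ p αlo αhi S) (hκ : ∀ x ∈ K.carrier, κ x = c) {v : Plane → ℝ}
    (hv : MemLocalPrimal K p v) :
    S (subPiNabla K κ p v) (subPiNabla K κ p v) ≤ αhi * (c * normSq K.carrier (fun x =>
      weakGrad K.carrier v x - pgrad (piNabla K κ p v) x)) := by
  refine (hS.upper _ (hv.memKerPiNabla_subPiNabla hκ)).trans_eq ?_
  rw [setIntegral_mul_eq_of_eqOn K.isOpen hκ]
  congr 2
  exact normSq_congr (weakGrad_sub_pev_ae_eq hv.memH1 (piNabla K κ p v))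

lemma IsMixedStab.subPiFlux_le {αlo αhi : ℝ} {S : (Plane → Plane) → (Plane → Plane) → ℝ}
    (hS : IsMixedStab K κ p αlo αhi S) (hκ : ∀ x ∈ K.carrier, κ x = c) {τ : Plane → Plane}
    {ψ : Plane → ℝ} (hτ : MemLocalFlux K p τ ψ) :
    S (subPiFlux K κ p τ) (subPiFlux K κ p τ) ≤ αhi * (c⁻¹ * normSq K.carrier (fun x =>
      τ x - piFlux K κ p τ x)) := by
  refine (hS.upper _ (hτ.memKerPiFlux_subPiFlux hκ)).trans_eq ?_
  rw [setIntegral_mul_eq_of_eqOn (w := fun x => (κ x)⁻¹) (c := c⁻¹) K.isOpen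
    fun x hx => by rw [hκ x hx]]
  rfl

/-- The local efficiency bound, for a field `G` and a flux `σ = -κ G` on the element. -/
lemma etaSq_le (hκ : ∀ x ∈ K.carrier, κ x = c) (hc : 0 < c)
    {αlo αhi αlo' αhi' : ℝ} {S : (Plane → ℝ) → (Plane → ℝ) → ℝ}
    {S' : (Plane → Plane) → (Plane → Plane) → ℝ}
    (hS : IsPrimalStab K κ p αlo αhi S) (hS' : IsMixedStab K κ p αlo' αhi' S')
    {v : Plane → ℝ} (hv : MemLocalPrimal K p v) {τ : Plane → Plane} {ψ : Plane → ℝ}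
    (hτ : MemLocalFlux K p τ ψ) {G σ : Plane → Plane}
    (hG : MemLp G 2 (volume.restrict K.carrier)) (hσ : MemLp σ 2 (volume.restrict K.carrier))
    (hσG : σ =ᵐ[volume.restrict K.carrier] fun x => -(κ x • G x))
    {q r : MvPolynomial (Fin 2) ℝ} (hq : DegLT (p + 1) q) (hr : DegLT (p + 2) r) :
    etaSq K κ p S S' v τ ≤
      4 * (1 + αhi) * normSq K.carrier (fun x => √(κ x) • (G x - weakGrad K.carrier v x))
      + 2 * (2 + αhi) * normSq K.carrier (fun x => √(κ x) • (G x - pgrad q x))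
      + 4 * (1 + αhi') * normSq K.carrier (fun x => (√(κ x))⁻¹ • (σ x - τ x))
      + 2 * (2 + αhi') * normSq K.carrier (fun x => (√(κ x))⁻¹ • (σ x - pgrad r x)) := by
  obtain ⟨R, hR, hPiR⟩ := exists_piFlux_eq (p := p) hκ hτ.memLp
  have hPi := hv.isPiNabla_piNabla hκ
  have hs1 := hS.subPiNabla_le hκ hv
  have hs2 := hS'.subPiFlux_le hκ hτ
  rw [etaSq]
  rw [hR] at hs2 ⊢
  set P := piNabla K κ p v
  have mem := memLp_pgrad K.isOpen K.isBounded
  have hy := hv.memH1.hasWeakGrad.memLp_grad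
  -- The difference `q - P` is itself an admissible test polynomial.
  have o1 : ∫ z in K.carrier, inner ℝ (weakGrad K.carrier v z - pgrad P z)
      (pgrad q z - pgrad P z) = 0 := by
    have := hPi.orthogonal _ (hq.sub hPi.degLT)
    rw [setIntegral_mul_eq_of_eqOn K.isOpen hκ] at this
    simpa only [pgrad_sub] using (mul_eq_zero.1 this).resolve_left hc.ne'
  have o2 : ∫ z in K.carrier, inner ℝ (τ z - pgrad R z) (pgrad r z - pgrad R z) = 0 := by
    have := hPiR.orthogonal _ (hr.sub hPiR.degLT)
    rw [setIntegral_mul_eq_of_eqOn (w := fun x => (κ x)⁻¹) (c := c⁻¹) K.isOpen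
      fun x hx => by rw [hκ x hx]] at this
    simpa only [pgrad_sub] using (mul_eq_zero.1 this).resolve_left (inv_pos.2 hc).ne'
  obtain ⟨b1, b2⟩ := normSq_sub_le_of_orthogonal hG hy (mem P) (mem q) o1
  obtain ⟨b3, b4⟩ := normSq_sub_le_of_orthogonal hσ hτ.memLp (mem R) (mem r) o2
  have w1 : ∀ F, normSq K.carrier (fun x => √(κ x) • F x) = c * normSq K.carrier F := fun F => by
    rw [normSq_smul_of_eqOn K.isOpen (c := √c) (fun x hx => by rw [hκ x hx]), Real.sq_sqrt hc.le]
  have w2 : ∀ F, normSq K.carrier (fun x => (√(κ x))⁻¹ • F x) = c⁻¹ * normSq K.carrier F :=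
    fun F => by
      rw [normSq_smul_of_eqOn K.isOpen (c := (√c)⁻¹) (fun x hx => by rw [hκ x hx]), inv_pow,
        Real.sq_sqrt hc.le]
  have h1 : normSq K.carrier (fun x => √(κ x) • pgrad P x + (√(κ x))⁻¹ • pgrad R x) ≤
      2 * (c * normSq K.carrier (fun x => G x - pgrad P x) +
        c⁻¹ * normSq K.carrier (fun x => σ x - pgrad R x)) := by
    have m1 : MemLp (fun x => √c • (G x - pgrad P x)) 2 (volume.restrict K.carrier) :=
      (hG.sub (mem P)).const_smul √c
    have m2 : MemLp (fun x => (√c)⁻¹ • (σ x - pgrad R x)) 2 (volume.restrict K.carrier) :=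
      (hσ.sub (mem R)).const_smul (√c)⁻¹
    have hadd := normSq_add_le m1 m2
    rw [normSq_smul_of_eqOn K.isOpen (w := fun _ => √c) (fun _ _ => rfl),
      normSq_smul_of_eqOn K.isOpen (w := fun _ => (√c)⁻¹) (fun _ _ => rfl), inv_pow,
      Real.sq_sqrt hc.le] at hadd
    refine le_of_eq_of_le (integral_congr_ae ?_) hadd
    filter_upwards [hσG, ae_restrict_mem K.isOpen.measurableSet] with x hx hxK
    rw [sqrt_smul_add_inv_sqrt_smul (G x) (pgrad P x) (σ x) (pgrad R x) hx, norm_neg, hκ x hxK]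
  have hα : 0 < αhi := hS.pos.trans_le hS.le
  have hα' : 0 < αhi' := hS'.pos.trans_le hS'.le
  simp only [w1, w2]
  have n1 := normSq_nonneg K.carrier (fun x => G x - weakGrad K.carrier v x)
  have n2 := normSq_nonneg K.carrier (fun x => G x - pgrad q x)
  have n3 := normSq_nonneg K.carrier (fun x => σ x - τ x)
  have n4 := normSq_nonneg K.carrier (fun x => σ x - pgrad r x)
  -- Writing `A`, `B` for the weighted squared errors against `y` and `q`, the primal part is at
  -- most `2(A + B) + 2α(A + B)`. The claimed `4(1 + α)A + 2(2 + α)B` exceeds this by the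
  -- nonnegative `2(1 + α)A + 2B`; the mixed part is the same.
  have c1 := mul_le_mul_of_nonneg_left b1 hc.le
  have c2 := mul_le_mul_of_nonneg_left (mul_le_mul_of_nonneg_left b2 hc.le) hα.le
  have c3 := mul_le_mul_of_nonneg_left b3 (inv_pos.2 hc).le
  have c4 := mul_le_mul_of_nonneg_left (mul_le_mul_of_nonneg_left b4 (inv_pos.2 hc).le) hα'.le
  have d1 := mul_nonneg hc.le n1
  have d2 := mul_nonneg hc.le n2
  have d3 := mul_nonneg (inv_pos.2 hc).le n3
  have d4 := mul_nonneg (inv_pos.2 hc).le n4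
  have f1 := mul_nonneg hα.le d1
  have f3 := mul_nonneg hα'.le d3
  linarith

end Local

end HypercircleVEM

/-! ### The efficiency theorem. -/

theorem mainTheorem4
    (Ω : PolygonalDomain) (ΓD ΓN : Set Plane) (hΓ : IsBoundarySplit Ω ΓD ΓN)
    (κ : Plane → ℝ) (kmin kmax : ℝ) (hkmin : 0 < kmin)
    (hκ : ∀ᵐ x ∂(volume.restrict Ω.carrier), kmin ≤ κ x ∧ κ x ≤ kmax)
    (f gD gN : Plane → ℝ) (hf : MemLp f 2 (volume.restrict Ω.carrier))
    (T : Mesh Ω) (hT : T.ConformsTo ΓD ΓN)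
    (p : ℕ) (hp : 1 ≤ p)
    -- the assumptions (G1), (G2), (K), (D)
    (γ γ' : ℝ) (hγ : 0 < γ) (hγ' : 0 < γ')
    (hG1 : T.StarShaped γ) (hG2 : T.EdgesComparable γ')
    (hK : T.PiecewiseConstant κ)
    (hgD : T.PiecewisePoly p ΓD gD) (hgN : T.PiecewisePoly p ΓN gN)
    -- the stabilizations of the primal (`S`) and of the mixed (`S'`) method
    (αlo αhi αlo' αhi' : Fin T.card → ℝ)
    (S : Fin T.card → (Plane → ℝ) → (Plane → ℝ) → ℝ)
    (S' : Fin T.card → (Plane → Plane) → (Plane → Plane) → ℝ)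
    (hS : ∀ i, IsPrimalStab (T.elem i) κ p (αlo i) (αhi i) (S i))
    (hS' : ∀ i, IsMixedStab (T.elem i) κ p (αlo' i) (αhi' i) (S' i))
    -- the continuous and the discrete solutions
    (ut : Plane → ℝ) (hut : IsPrimalSolution Ω ΓD ΓN κ f gD gN ut)
    (σ : Plane → Plane) (u : Plane → ℝ) (hσ : IsMixedSolution Ω ΓD ΓN κ f gD gN σ u)
    (utn : Plane → ℝ) (hutn : IsPrimalVEMSolution T ΓD ΓN κ f gD gN p S utn)
    (σn : Plane → Plane) (un : Plane → ℝ)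
    (hσn : IsMixedVEMSolution T ΓD ΓN κ f gD gN p S' σn un) :
    ∀ i : Fin T.card,
      (etaSq (T.elem i) κ p (S i) (S' i) utn σn ≤
        4 * (1 + αhi i) * normSq (T.elem i).carrier (fun x =>
            √(κ x) • (weakGrad Ω.carrier ut x - weakGrad (T.elem i).carrier utn x))
        + 2 * (2 + αhi i) * normSq (T.elem i).carrier (fun x =>
            √(κ x) • (weakGrad Ω.carrier ut x - pgrad (piNabla (T.elem i) κ p utn) x))
        + 4 * (1 + αhi' i) * normSq (T.elem i).carrier (fun x =>
            (√(κ x))⁻¹ • (σ x - σn x))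
        + 2 * (2 + αhi' i) * normSq (T.elem i).carrier (fun x =>
            (√(κ x))⁻¹ • (σ x - piFlux (T.elem i) κ p σn x)))
      ∧
      ∀ q r : MvPolynomial (Fin 2) ℝ, DegLT (p + 1) q → DegLT (p + 2) r →
        etaSq (T.elem i) κ p (S i) (S' i) utn σn ≤
          4 * (1 + αhi i) * normSq (T.elem i).carrier (fun x =>
              √(κ x) • (weakGrad Ω.carrier ut x - weakGrad (T.elem i).carrier utn x))
          + 2 * (2 + αhi i) * normSq (T.elem i).carrier (fun x =>
              √(κ x) • (weakGrad Ω.carrier ut x - pgrad q x))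
          + 4 * (1 + αhi' i) * normSq (T.elem i).carrier (fun x =>
              (√(κ x))⁻¹ • (σ x - σn x))
          + 2 * (2 + αhi' i) * normSq (T.elem i).carrier (fun x =>
              (√(κ x))⁻¹ • (σ x - pgrad r x)) := by
  intro i
  obtain ⟨c, hc⟩ := hK i
  have hmono : volume.restrict (T.elem i).carrier ≤ volume.restrict Ω.carrier :=
    Measure.restrict_mono (T.subset i) le_rfl
  have hcpos : 0 < c := PolygonalDomain.pos_of_ae_le hc hkmin
    (ae_mono hmono (hκ.mono fun x hx => hx.1))
  have hv := hutn.mem.mem_local i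
  obtain ⟨ψ, hψ⟩ := hσn.mem_flux
  have hτ := hψ.mem_local i
  have hσG := ae_mono hmono
    (hσ.ae_eq_neg_smul_weakGrad hut hf hkmin hκ hK.aestronglyMeasurable)
  have key : ∀ q r : MvPolynomial (Fin 2) ℝ, DegLT (p + 1) q → DegLT (p + 2) r → _ :=
    fun q r hq hr => etaSq_le hc hcpos (hS i) (hS' i) hv hτ
      (hut.memH1.hasWeakGrad.memLp_grad.mono_measure hmono)
      (hσ.mem.memHdiv.hasWeakDiv.memLp.mono_measure hmono) hσG hq hr
  refine ⟨?_, key⟩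
  -- The projections are themselves admissible choices of `q` and `∇r`.
  obtain ⟨R, hR, hPiR⟩ := exists_piFlux_eq (p := p) hc hτ.memLp
  rw [hR]
  exact key _ R (hv.isPiNabla_piNabla hc).degLT hPiR.degLT
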